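/- Consider a step-stress accelerated life test with $k\ge 2$ stress levels $x_1<\dots<x_k$ and inspection times $0=t_0<t_1<\dots<t_L$ which include the times of stress change $0=\tau_0<\tau_1<\dots<\tau_k=t_L$ ($\tau_i=t_{l_i}$ with $0=l_0<l_1<\dots<l_k=L$). For $\theta=(\theta_0,\theta_1)^T\in\Theta=(0,\infty)\times\mathbb{R}$ let $\lambda_i=\theta_0e^{\theta_1x_i}$ be the failure rate at stress $x_i$. For $i=1,\dots,k$ let $a_{i-1}=\lambda_i^{-1}\sum_{l=1}^{i-1}(\tau_l-\tau_{l-1})\lambda_l$ and $a^*_{i-1}=\lambda_i^{-1}\sum_{l=1}^{i-1}\lambda_l(\tau_l-\tau_{l-1})(x_l-x_i)$. Under the cumulative exposure model, a lifetime has distribution function $G_T(0)=0$, $G_T(t)=1-e^{-\lambda_i(t+a_{i-1}-\tau_{i-1})}$ and density $g_T(t)=\lambda_ie^{-\lambda_i(t+a_{i-1}-\tau_{i-1})}$ for $t>0$, where $i$ is the stress level in force from time $t$ on ($\tau_{i-1}\le t<\tau_i$, or $i=k$ if $t\ge\tau_{k-1}$). Let $\pi_j(\theta)=G_T(t_j)-G_T(t_{j-1})$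 for $1\le j\le L$, $\pi_{L+1}(\theta)=1-G_T(t_L)$, and $\pi(\theta)=(\pi_1(\theta),\dots,\pi_{L+1}(\theta))^T$. Let $W=W(\theta)$ be the $(L+1)\times2$ matrix with rows $w_j=z_j-z_{j-1}$, where $z_0=z_{L+1}=0$ and, for $1\le j\le L$, with $i$ the stress level in force from time $t_j$ on, $$z_j=g_T(t_j)\Big(\tfrac{t_j+a_{i-1}-\tau_{i-1}}{\theta_0},\ (t_j+a_{i-1}-\tau_{i-1})x_i+a^*_{i-1}\Big).$$ With $D_{\pi}=\mathrm{diag}(\pi_1(\theta),\dots,\pi_{L+1}(\theta))$ and $\pi^\beta=(\pi_1(\theta)^\beta,\dots,\pi_{L+1}(\theta)^\beta)^T$ put $$J_\beta(\theta)=W^TD_{\pi}^{\beta-1}W,\qquad K_\beta(\theta)=W^T\big(D_{\pi}^{2\beta-1}-\pi^\beta(\pi^\beta)^T\big)W .$$ Let $\beta\ge0$, $m\in\mathbb{R}^2\setminus\{0\}$ and $d\in\mathbb{R}$. Let the true parameter $\theta^\circ\in\Theta$ satisfy the null hypothesis $m^T\theta^\circ=d$. For each $N$ let the vector of counts $(n_1,\dots,n_{L+1})$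 be multinomially distributed with $N$ trials and probability vector $\pi(\theta^\circ)$, and let $\widehat p=(n_1/N,\dots,n_{L+1}/N)$. Let $\widehat\theta^\beta$ be a minimum density power divergence estimator, that is, a function of the counts that is a minimizer over $\theta\in\Theta$ of $d_\beta(\widehat p,\pi(\theta))$ whenever a minimizer exists (and arbitrary otherwise), where for probability vectors $p$ and $q$ $$d_\beta(p,q)=\sum_{j=1}^{L+1}\Big(q_j^{1+\beta}-\big(1+\tfrac1\beta\big)p_jq_j^{\beta}+\tfrac1\beta p_j^{1+\beta}\Big)\ \ (\beta>0),\qquad d_0(p,q)=\sum_{j=1}^{L+1}p_j\log\frac{p_j}{q_j}.$$ Then, as $N\to\infty$, $$Z_N(\widehat\theta^\beta)=\sqrt N\,\Big(m^TJ_\beta^{-1}(\widehat\theta^\beta)K_\beta(\widehat\theta^\beta)J_\beta^{-1}(\widehat\theta^\beta)\,m\Big)^{-1/2}\big(m^T\widehat\theta^\beta-d\big)\ \longrightarrow\ \mathcal N(0,1)\quad\text{in distribution.}$$ -/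

import Mathlib

open MeasureTheory ProbabilityTheory Filter Matrix

/-- The design of a step-stress accelerated life test with `k ≥ 2` stress levels
`x 1 < ⋯ < x k` and `L` inspection times `0 = t 0 < t 1 < ⋯ < t L`, among which the times of
stress change `τ i = t (l i)`, where `0 = l 0 < l 1 < ⋯ < l k = L`.  Only the values of `x` on
`1, …, k`, of `t` on `0, …, L` and of `l` on `0, …, k` are used. -/
structure StepStressPlan where
  /-- number of stress levels -/
  k : ℕ
  /-- number of inspection times -/
  L : ℕ
  /-- stress levels -/
  x : ℕ → ℝ
  /-- inspection times -/
  t : ℕ → ℝ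
  /-- `l i` is the number of inspection times up to the `i`-th time of stress change -/
  l : ℕ → ℕ
  two_le_k : 2 ≤ k
  x_lt : ∀ i, 1 ≤ i → i < k → x i < x (i + 1)
  t_zero : t 0 = 0
  t_lt : ∀ j, j < L → t j < t (j + 1)
  l_zero : l 0 = 0
  l_lt : ∀ i, i < k → l i < l (i + 1)
  l_last : l k = L

/-- The parameter space `Θ = (0, ∞) × ℝ`; a parameter is `θ = (θ 0, θ 1)`. -/
def paramSpace : Set (Fin 2 → ℝ) := {θ | 0 < θ 0}

namespace StepStressPlan

noncomputable section

variable (S : StepStressPlan)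

/-- The times of stress change `τ_1 < ⋯ < τ_k` (`τ_k` is the end of the experiment), `τ_0 = 0`. -/
def τ (i : ℕ) : ℝ := S.t (S.l i)

/-- The failure rate `λ_i(θ) = θ_0 exp (θ_1 x_i)` at the `i`-th stress level. -/
def rate (θ : Fin 2 → ℝ) (i : ℕ) : ℝ := θ 0 * Real.exp (θ 1 * S.x i)

/-- The shift of the cumulative exposure model at stress level `i`, usually written `a_{i-1}`:
`(∑_{l=1}^{i-1} (τ_l - τ_{l-1}) λ_l) / λ_i`. -/
def shift (θ : Fin 2 → ℝ) (i : ℕ) : ℝ :=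
  (∑ r ∈ Finset.Icc 1 (i - 1), (S.τ r - S.τ (r - 1)) * S.rate θ r) / S.rate θ i

/-- The derivative of `shift` in `θ_1`, usually written `a*_{i-1}`:
`(1 / λ_i) ∑_{l=1}^{i-1} λ_l (τ_l - τ_{l-1}) (-x_i + x_l)`. -/
def shiftStar (θ : Fin 2 → ℝ) (i : ℕ) : ℝ :=
  (1 / S.rate θ i) *
    ∑ r ∈ Finset.Icc 1 (i - 1), S.rate θ r * (S.τ r - S.τ (r - 1)) * (-S.x i + S.x r)

open Classical in
/-- The index `i ∈ {1, …, k}` of the stress level in force at, and immediately after, time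
`s ≥ 0`: the `i` with `τ_{i-1} ≤ s < τ_i`, and `i = k` for all `s ≥ τ_{k-1}`. -/
def stage (s : ℝ) : ℕ := Nat.findGreatest (fun i => S.τ i ≤ s) (S.k - 1) + 1

/-- The exposure-adjusted time `s + a_{i-1} - τ_{i-1}`, where `i` is the stage at time `s`. -/
def shiftedTime (θ : Fin 2 → ℝ) (s : ℝ) : ℝ :=
  s + S.shift θ (S.stage s) - S.τ (S.stage s - 1)

/-- The distribution function `G_T` of the lifetime of a device. -/
def cdfT (θ : Fin 2 → ℝ) (s : ℝ) : ℝ :=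
  if s ≤ 0 then 0 else 1 - Real.exp (-(S.rate θ (S.stage s) * S.shiftedTime θ s))

/-- The density `g_T` of the lifetime of a device, for positive times. -/
def densT (θ : Fin 2 → ℝ) (s : ℝ) : ℝ :=
  S.rate θ (S.stage s) * Real.exp (-(S.rate θ (S.stage s) * S.shiftedTime θ s))

/-- The cell probabilities `π_1(θ), …, π_{L+1}(θ)`.  The index `c : Fin (L + 1)` stands for the
cell `j = c + 1`: failure in `(t_{j-1}, t_j]` if `j ≤ L`, survival beyond `t_L` if `j = L + 1`. -/
def cellProb (θ : Fin 2 → ℝ) (c : Fin (S.L + 1)) : ℝ :=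
  if (c : ℕ) < S.L then S.cdfT θ (S.t (c + 1)) - S.cdfT θ (S.t c) else 1 - S.cdfT θ (S.t S.L)

/-- The vectors `z_0 = 0`, `z_1, …, z_L`, `z_{L+1} = 0`. -/
def z (θ : Fin 2 → ℝ) (j : ℕ) : Fin 2 → ℝ :=
  if j = 0 ∨ j = S.L + 1 then 0
  else S.densT θ (S.t j) •
    ![S.shiftedTime θ (S.t j) / θ 0,
      S.shiftedTime θ (S.t j) * S.x (S.stage (S.t j)) + S.shiftStar θ (S.stage (S.t j))]

/-- The `(L + 1) × 2` matrix `W` with rows `w_j = z_j - z_{j-1}`, `j = 1, …, L + 1`. -/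
def W (θ : Fin 2 → ℝ) : Matrix (Fin (S.L + 1)) (Fin 2) ℝ :=
  Matrix.of fun c => S.z θ (c + 1) - S.z θ c

/-- `J_β(θ) = Wᵀ D_π^{β-1} W`. -/
def J (β : ℝ) (θ : Fin 2 → ℝ) : Matrix (Fin 2) (Fin 2) ℝ :=
  (S.W θ)ᵀ * Matrix.diagonal (fun c => S.cellProb θ c ^ (β - 1)) * S.W θ

/-- `K_β(θ) = Wᵀ (D_π^{2β-1} - π^β (π^β)ᵀ) W`. -/
def K (β : ℝ) (θ : Fin 2 → ℝ) : Matrix (Fin 2) (Fin 2) ℝ :=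
  (S.W θ)ᵀ *
    (Matrix.diagonal (fun c => S.cellProb θ c ^ (2 * β - 1)) -
      Matrix.vecMulVec (fun c => S.cellProb θ c ^ β) (fun c => S.cellProb θ c ^ β)) *
    S.W θ

end

end StepStressPlan

noncomputable section

/-- The density power divergence between probability vectors `p` and `q` with tuning parameter
`β ≥ 0`; for `β = 0` it is the Kullback–Leibler divergence. -/
def densityPowerDivergence {ι : Type*} [Fintype ι] (β : ℝ) (p q : ι → ℝ) : ℝ :=
  if β = 0 then ∑ j, p j * Real.log (p j / q j)
  else ∑ j, (q j ^ (1 + β) - (1 + 1 / β) * p j * q j ^ β + 1 / β * p j ^ (β + 1))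

/-- The empirical probability vector `(n_1 / N, …, n_{L+1} / N)`. -/
def empiricalProb {ι : Type*} (N : ℕ) (n : ι → ℕ) (j : ι) : ℝ := (n j : ℝ) / (N : ℝ)

/-- The multinomial distribution with `N` trials and probability vector `p`, as a measure on the
vectors of counts. -/
def multinomialMeasure {ι : Type*} [Fintype ι] [DecidableEq ι] (N : ℕ) (p : ι → ℝ) :
    Measure (ι → ℕ) :=
  ∑ n ∈ Finset.piAntidiag Finset.univ N,
    ENNReal.ofReal ((Nat.multinomial Finset.univ n : ℝ) * ∏ j, p j ^ n j) • Measure.dirac n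

namespace StepStressPlan

variable (S : StepStressPlan)

/-- `θ` minimizes over `Θ` the density power divergence between the empirical probability vector
of the counts `n` and the model probability vector. -/
def IsDPDMinimizer (β : ℝ) (N : ℕ) (n : Fin (S.L + 1) → ℕ) (θ : Fin 2 → ℝ) : Prop :=
  θ ∈ paramSpace ∧
    IsMinOn (fun η => densityPowerDivergence β (empiricalProb N n) (S.cellProb η)) paramSpace θ

/-- `est` is a minimum density power divergence estimator: for every sample (number `N` of devices,
vector of counts `n` with sum `N`), `est N n` is a minimizer over `Θ` of the divergence whenever
there is one.  For the samples without a minimizer its value is arbitrary. -/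
def IsMDPDE (β : ℝ) (est : ℕ → (Fin (S.L + 1) → ℕ) → Fin 2 → ℝ) : Prop :=
  ∀ (N : ℕ) (n : Fin (S.L + 1) → ℕ), ∑ j, n j = N →
    (∃ θ, S.IsDPDMinimizer β N n θ) → S.IsDPDMinimizer β N n (est N n)

/-- The Z-type statistic
`√N (mᵀ J_β⁻¹(θ) K_β(θ) J_β⁻¹(θ) m)^{-1/2} (mᵀ θ - d)`, to be evaluated at the estimate `θ`. -/
def zStat (β : ℝ) (m : Fin 2 → ℝ) (d : ℝ) (N : ℕ) (θ : Fin 2 → ℝ) : ℝ :=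
  Real.sqrt N * (m ⬝ᵥ (((S.J β θ)⁻¹ * S.K β θ * (S.J β θ)⁻¹) *ᵥ m)) ^ (-(1 / 2) : ℝ) *
    (m ⬝ᵥ θ - d)

end StepStressPlan

end

/-! The statistic is a function of the empirical vector `p̂` of cell frequencies, and the theorem is
an instance of the delta method.

The cell probabilities are differences of consecutive survival probabilities `exp (-H(t_j))`, where
the cumulative hazard `H(t_j)` is a linear combination of the failure rates with the exposure times
as coefficients.  This formula shows that `W` is the Jacobian of `θ ↦ π(θ)`
(`hasFDerivAt_cellProb`), that `W` has rank two (`eq_zero_of_W_mulVec_eq_zero`), and that `θ` is a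
continuous function of `π(θ)` (`exists_continuousAt_leftInverse_cellProb`): the hazards accumulated
up to `τ 1` and `τ 2` give the two lowest rates, and these give `θ` because `x 1 ≠ x 2`.

The divergence separates probability vectors uniformly (`exists_le_densityPowerDivergence`).
Hence for `p` near `π(θ₀)` a minimizer exists (`eventually_exists_isDivergenceMin`) and every
minimizer is near `θ₀` (`tendsto_snd_minFilter`).  A minimizer satisfies the estimating equations
`Wᵀ D_π^{β-1} (π(θ) - p) = 0`; expanding `π` to first order at `θ₀` gives
`θ - θ₀ = J_β⁻¹ Wᵀ D_π^{β-1} (p - π(θ₀)) + o(p - π(θ₀))` (`minimizer_sub_isLittleO`), with no need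
for second derivatives.  All this is deterministic: it concerns pairs of a vector `p` and a
minimizer for it, so no measurability of the estimator has to be discussed.

It follows that the studentized functional is differentiable at `π(θ₀)`, with a gradient `a`
(`influence`) whose variance under `π(θ₀)` is `1`.  Finally `√N a ⬝ᵥ (p̂ - π(θ₀))` tends to
`𝒩(0, 1)` by the central limit theorem, and `√N (p̂ - π(θ₀))` is tight, so that the remainder
vanishes in probability (`tendstoInDistribution_of_linearization`).  The multinomial counts are not
realized as sums of independent variables: the characteristic function of a linear form in them is
the `N`-th power of that of one trial, by the multinomial theorem. -/

open scoped Topology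

/-! ### Cumulative hazard, cell probabilities and their Jacobian -/

namespace StepStressPlan

variable (S : StepStressPlan)

lemma t_strictMonoOn : StrictMonoOn S.t (Set.Iic S.L) :=
  strictMonoOn_of_lt_add_one Set.ordConnected_Iic fun j _ _ hj ↦ S.t_lt j hj

lemma l_strictMonoOn : StrictMonoOn S.l (Set.Iic S.k) :=
  strictMonoOn_of_lt_add_one Set.ordConnected_Iic fun j _ _ hj ↦ S.l_lt j hj

lemma l_le {i : ℕ} (hi : i ≤ S.k) : S.l i ≤ S.L :=
  S.l_last ▸ S.l_strictMonoOn.monotoneOn hi (Set.mem_Iic.2 le_rfl) hi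

lemma τ_strictMonoOn : StrictMonoOn S.τ (Set.Iic S.k) := fun _ hi _ hj h ↦
  S.t_strictMonoOn (S.l_le hi) (S.l_le hj) (S.l_strictMonoOn hi hj h)

lemma τ_zero : S.τ 0 = 0 := by rw [τ, S.l_zero, S.t_zero]

lemma τ_k : S.τ S.k = S.t S.L := by rw [τ, S.l_last]

lemma t_nonneg {j : ℕ} (hj : j ≤ S.L) : 0 ≤ S.t j :=
  S.t_zero ▸ S.t_strictMonoOn.monotoneOn (Nat.zero_le _) hj (Nat.zero_le _)

lemma t_le_τ_k {j : ℕ} (hj : j ≤ S.L) : S.t j ≤ S.τ S.k :=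
  S.τ_k ▸ S.t_strictMonoOn.monotoneOn hj (Set.mem_Iic.2 le_rfl) hj

lemma one_le_stage (s : ℝ) : 1 ≤ S.stage s := Nat.le_add_left _ _

lemma stage_le (s : ℝ) : S.stage s ≤ S.k := by
  have h := Nat.findGreatest_le (P := fun i => S.τ i ≤ s) (S.k - 1)
  have := S.two_le_k
  unfold stage
  convert (show Nat.findGreatest (fun i => S.τ i ≤ s) (S.k - 1) + 1 ≤ S.k by omega)

lemma τ_stage_sub_one_le {s : ℝ} (hs : 0 ≤ s) : S.τ (S.stage s - 1) ≤ s := by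
  classical
  have := Nat.findGreatest_spec (P := fun i => S.τ i ≤ s) (Nat.zero_le (S.k - 1))
    (by simpa [S.τ_zero] using hs)
  unfold stage
  rw [Nat.add_sub_cancel]
  convert this

lemma le_τ_stage {s : ℝ} (hs : s ≤ S.τ S.k) : s ≤ S.τ (S.stage s) := by
  classical
  rcases (S.stage_le s).eq_or_lt with h | h
  · rwa [h]
  · by_contra! hlt
    have h2 : S.stage s ≤ S.k - 1 := by omega
    have h1 : S.stage s ≤ Nat.findGreatest (fun i => S.τ i ≤ s) (S.k - 1) :=
      Nat.le_findGreatest (P := fun i => S.τ i ≤ s) h2 hlt.le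
    have h3 : S.stage s = Nat.findGreatest (fun i => S.τ i ≤ s) (S.k - 1) + 1 := by
      unfold stage
      convert rfl
    omega

/-- The time spent at stress level `r` by a device that is observed up to time `s`. -/
noncomputable def exposure (s : ℝ) (r : ℕ) : ℝ := min s (S.τ r) - min s (S.τ (r - 1))

lemma exposure_nonneg (s : ℝ) {r : ℕ} (hr : r ≤ S.k) : 0 ≤ S.exposure s r :=
  sub_nonneg.2 <| min_le_min_left _ <|
    S.τ_strictMonoOn.monotoneOn (show r - 1 ≤ S.k by omega) hr (Nat.sub_le _ _)

lemma exposure_mono {s s' : ℝ} (h : s ≤ s') {r : ℕ} (hr : r ≤ S.k) :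
    S.exposure s r ≤ S.exposure s' r := by
  have : S.τ (r - 1) ≤ S.τ r :=
    S.τ_strictMonoOn.monotoneOn (show r - 1 ≤ S.k by omega) hr (Nat.sub_le _ _)
  unfold exposure
  rcases le_total s (S.τ r) with h1 | h1 <;> rcases le_total s (S.τ (r - 1)) with h2 | h2 <;>
  rcases le_total s' (S.τ r) with h3 | h3 <;> rcases le_total s' (S.τ (r - 1)) with h4 | h4 <;>
  simp only [min_eq_left, min_eq_right, *] <;> linarith

lemma sum_exposure {s : ℝ} (h0 : 0 ≤ s) (hk : s ≤ S.τ S.k) :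
    ∑ r ∈ Finset.Icc 1 S.k, S.exposure s r = s := by
  have h := Finset.sum_range_sub (fun r ↦ min s (S.τ r)) S.k
  rw [S.τ_zero, min_eq_right h0, min_eq_left hk, sub_zero] at h
  refine Eq.trans ?_ h
  rw [Finset.range_eq_Ico]
  exact (Finset.sum_Ico_add' (fun r ↦ S.exposure s r) 0 S.k 1).symm

/-- Up to the stage in force at time `s` the exposures are the lengths of the stages; the stage in
force contributes the time since its start, the later ones nothing. -/
lemma sum_exposure_mul {s : ℝ} (h0 : 0 ≤ s) (hk : s ≤ S.τ S.k) (f : ℕ → ℝ) :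
    ∑ r ∈ Finset.Icc 1 S.k, S.exposure s r * f r =
      ∑ r ∈ Finset.Icc 1 (S.stage s - 1), (S.τ r - S.τ (r - 1)) * f r +
        (s - S.τ (S.stage s - 1)) * f (S.stage s) := by
  have hi1 := S.one_le_stage s
  have hik := S.stage_le s
  have hlo := S.τ_stage_sub_one_le h0
  have hhi := S.le_τ_stage hk
  have hτ := S.τ_strictMonoOn.monotoneOn
  generalize S.stage s = i at *
  have hsub : Finset.Icc 1 i ⊆ Finset.Icc 1 S.k := Finset.Icc_subset_Icc le_rfl hik
  rw [← Finset.sum_subset hsub]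
  · obtain ⟨i, rfl⟩ : ∃ i', i = i' + 1 := ⟨i - 1, by omega⟩
    rw [Finset.sum_Icc_succ_top (by omega), Nat.add_sub_cancel] at *
    congr 1
    · refine Finset.sum_congr rfl fun r hr ↦ ?_
      rw [Finset.mem_Icc] at hr
      have h1 : S.τ r ≤ S.τ i := hτ (show r ≤ S.k by omega) (show i ≤ S.k by omega) hr.2
      have h2 : S.τ (r - 1) ≤ S.τ i :=
        hτ (show r - 1 ≤ S.k by omega) (show i ≤ S.k by omega) (by omega)
      rw [exposure, min_eq_right (h1.trans hlo), min_eq_right (h2.trans hlo)]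
    · rw [exposure, min_eq_left hhi, Nat.add_sub_cancel, min_eq_right hlo]
  · intro r hr hr'
    simp only [Finset.mem_Icc] at hr hr'
    have h1 : S.τ i ≤ S.τ r := hτ hik hr.2 (by omega)
    have h2 : S.τ i ≤ S.τ (r - 1) := hτ hik (show r - 1 ≤ S.k by omega) (by omega)
    rw [exposure, min_eq_left (hhi.trans h1), min_eq_left (hhi.trans h2), sub_self, zero_mul]

/-- The cumulative hazard at time `s`, written as a combination of the failure rates. -/
noncomputable def cumHazard (θ : Fin 2 → ℝ) (s : ℝ) : ℝ :=
  ∑ r ∈ Finset.Icc 1 S.k, S.exposure s r * S.rate θ r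

variable {S} {θ : Fin 2 → ℝ}

lemma rate_pos (hθ : θ ∈ paramSpace) (r : ℕ) : 0 < S.rate θ r := mul_pos hθ (Real.exp_pos _)

lemma rate_mul_shiftedTime (hθ : θ ∈ paramSpace) {s : ℝ} (h0 : 0 ≤ s) (hk : s ≤ S.τ S.k) :
    S.rate θ (S.stage s) * S.shiftedTime θ s = S.cumHazard θ s := by
  have := (S.rate_pos hθ (S.stage s)).ne'
  rw [cumHazard, S.sum_exposure_mul h0 hk, shiftedTime, shift]
  field_simp
  ring

lemma rate_mul_shiftedTime_mul_add (hθ : θ ∈ paramSpace) {s : ℝ} (h0 : 0 ≤ s)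
    (hk : s ≤ S.τ S.k) :
    S.rate θ (S.stage s) *
        (S.shiftedTime θ s * S.x (S.stage s) + S.shiftStar θ (S.stage s)) =
      ∑ r ∈ Finset.Icc 1 S.k, S.exposure s r * (S.rate θ r * S.x r) := by
  have := (S.rate_pos hθ (S.stage s)).ne'
  rw [mul_add, ← mul_assoc, rate_mul_shiftedTime hθ h0 hk, cumHazard, S.sum_exposure_mul h0 hk,
    S.sum_exposure_mul h0 hk, shiftStar, add_mul, Finset.sum_mul, ← mul_assoc, mul_one_div_cancel
    this, one_mul, add_right_comm, ← Finset.sum_add_distrib]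
  congr 1
  · exact Finset.sum_congr rfl fun r _ ↦ by ring
  · ring

lemma cumHazard_zero : S.cumHazard θ 0 = 0 := by
  refine Finset.sum_eq_zero fun r hr ↦ ?_
  have hr := Finset.mem_Icc.1 hr
  have h (i : ℕ) (hi : i ≤ S.k) : 0 ≤ S.τ i := S.t_nonneg (S.l_le hi)
  rw [exposure, min_eq_left (h r hr.2), min_eq_left (h _ (by omega)), sub_self, zero_mul]

lemma cumHazard_lt (hθ : θ ∈ paramSpace) {s s' : ℝ} (h0 : 0 ≤ s) (h : s < s')
    (hk : s' ≤ S.τ S.k) : S.cumHazard θ s < S.cumHazard θ s' := by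
  refine Finset.sum_lt_sum (fun r hr ↦ ?_) ?_
  · exact mul_le_mul_of_nonneg_right (S.exposure_mono h.le (Finset.mem_Icc.1 hr).2)
      (rate_pos hθ r).le
  · by_contra! hc
    have : s' ≤ s := by
      rw [← S.sum_exposure (h0.trans h.le) hk, ← S.sum_exposure h0 (h.le.trans hk)]
      exact Finset.sum_le_sum fun r hr ↦ le_of_mul_le_mul_right (hc r hr) (rate_pos hθ r)
    exact this.not_gt h

variable (S) in
/-- The probability of surviving the first `j` inspection times, with the value `0` for
`j = L + 1`, so that every cell probability is a difference of consecutive values. -/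
noncomputable def surv (θ : Fin 2 → ℝ) (j : ℕ) : ℝ :=
  if j ≤ S.L then Real.exp (-S.cumHazard θ (S.t j)) else 0

lemma one_sub_cdfT (hθ : θ ∈ paramSpace) {j : ℕ} (hj : j ≤ S.L) :
    1 - S.cdfT θ (S.t j) = S.surv θ j := by
  have h0 := S.t_nonneg hj
  rw [cdfT, surv, if_pos hj]
  split_ifs with h
  · rw [le_antisymm h h0, cumHazard_zero]; simp
  · rw [rate_mul_shiftedTime hθ h0 (S.t_le_τ_k hj)]; ring

lemma cellProb_eq_surv_sub (hθ : θ ∈ paramSpace) (c : Fin (S.L + 1)) :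
    S.cellProb θ c = S.surv θ c - S.surv θ (c + 1) := by
  have hc := c.is_le
  rw [cellProb]
  split_ifs with h
  · rw [← one_sub_cdfT hθ h, ← one_sub_cdfT hθ hc]; ring
  · have : (c : ℕ) = S.L := by omega
    rw [one_sub_cdfT hθ le_rfl, this, surv.eq_def _ _ (S.L + 1), if_neg (by omega), sub_zero]

lemma cellProb_pos (hθ : θ ∈ paramSpace) (c : Fin (S.L + 1)) : 0 < S.cellProb θ c := by
  have hc := c.is_le
  rw [cellProb_eq_surv_sub hθ, sub_pos, surv, surv, if_pos hc]
  split_ifs with h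
  · rw [Real.exp_lt_exp, neg_lt_neg_iff]
    exact cumHazard_lt hθ (S.t_nonneg hc) (S.t_lt _ h) (S.t_le_τ_k h)
  · exact Real.exp_pos _

lemma sum_cellProb_lt (hθ : θ ∈ paramSpace) (j : ℕ) (hj : j ≤ S.L + 1) :
    ∑ c : Fin (S.L + 1), (if (c : ℕ) < j then S.cellProb θ c else 0) = 1 - S.surv θ j := by
  have h0 : S.surv θ 0 = 1 := by simp [surv, S.t_zero, cumHazard_zero]
  simp only [← h0, cellProb_eq_surv_sub hθ]
  rw [Fin.sum_univ_eq_sum_range (fun i ↦ if i < j then S.surv θ i - S.surv θ (i + 1) else 0),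
    ← Finset.sum_filter, ← Finset.sum_range_sub']
  congr 1
  ext i
  simp only [Finset.mem_filter, Finset.mem_range]
  omega

lemma sum_cellProb (hθ : θ ∈ paramSpace) : ∑ c, S.cellProb θ c = 1 := by
  have h := sum_cellProb_lt (S := S) hθ (S.L + 1) le_rfl
  rw [surv, if_neg (by omega), sub_zero] at h
  rw [← h]
  exact Finset.sum_congr rfl fun c _ ↦ by rw [if_pos c.2]

/-- The linear form `u ↦ w ⬝ᵥ u`. -/
noncomputable def dotCLM (w : Fin 2 → ℝ) : (Fin 2 → ℝ) →L[ℝ] ℝ :=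
  w 0 • ContinuousLinearMap.proj 0 + w 1 • ContinuousLinearMap.proj 1

lemma dotCLM_apply (w u : Fin 2 → ℝ) : dotCLM w u = w ⬝ᵥ u := by
  simp [dotCLM, dotProduct, Fin.sum_univ_two]

lemma hasFDerivAt_rate (hθ : θ ∈ paramSpace) (r : ℕ) :
    HasFDerivAt (fun η ↦ S.rate η r) (dotCLM ![S.rate θ r / θ 0, S.rate θ r * S.x r]) θ := by
  have h0 : HasFDerivAt (fun η : Fin 2 → ℝ ↦ η 0)
    (ContinuousLinearMap.proj 0 : (Fin 2 → ℝ) →L[ℝ] ℝ) θ := hasFDerivAt_apply 0 θ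
  have h1 : HasFDerivAt (fun η : Fin 2 → ℝ ↦ η 1)
    (ContinuousLinearMap.proj 1 : (Fin 2 → ℝ) →L[ℝ] ℝ) θ := hasFDerivAt_apply 1 θ
  refine (h0.mul (h1.mul_const (S.x r)).exp).congr_fderiv ?_
  have : θ 0 ≠ 0 := ne_of_gt hθ
  ext u
  simp [dotCLM, rate]
  field_simp
  ring

lemma hasFDerivAt_cumHazard (hθ : θ ∈ paramSpace) (s : ℝ) :
    HasFDerivAt (fun η ↦ S.cumHazard η s)
      (dotCLM ![S.cumHazard θ s / θ 0,
        ∑ r ∈ Finset.Icc 1 S.k, S.exposure s r * (S.rate θ r * S.x r)]) θ := by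
  refine (HasFDerivAt.fun_sum fun r _ ↦ (hasFDerivAt_rate hθ r).const_mul
    (S.exposure s r)).congr_fderiv ?_
  ext u
  simp [dotCLM, cumHazard, Finset.sum_add_distrib, Finset.sum_mul, Finset.sum_div]
  congr 1 <;> exact Finset.sum_congr rfl fun r _ ↦ by ring

lemma z_eq (hθ : θ ∈ paramSpace) {j : ℕ} (hj : j ≤ S.L) :
    S.z θ j = Real.exp (-S.cumHazard θ (S.t j)) • ![S.cumHazard θ (S.t j) / θ 0,
      ∑ r ∈ Finset.Icc 1 S.k, S.exposure (S.t j) r * (S.rate θ r * S.x r)] := by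
  have h0 := S.t_nonneg hj
  have hk := S.t_le_τ_k hj
  rw [z]
  split_ifs with h
  · obtain rfl : j = 0 := by omega
    have hz : S.cumHazard θ 0 = 0 := cumHazard_zero
    have hx (r : ℕ) (hr : r ∈ Finset.Icc 1 S.k) : S.exposure 0 r = 0 := by
      have hs : S.exposure 0 r * S.rate θ r = 0 :=
        (Finset.sum_eq_zero_iff_of_nonneg fun r hr ↦ mul_nonneg
          (S.exposure_nonneg 0 (Finset.mem_Icc.1 hr).2) (rate_pos hθ r).le).1 hz r hr
      exact (mul_eq_zero.1 hs).resolve_right (rate_pos hθ r).ne'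
    rw [S.t_zero, hz, Finset.sum_eq_zero fun r hr ↦ by rw [hx r hr, zero_mul]]
    ext i
    fin_cases i <;> simp
  · rw [densT, rate_mul_shiftedTime hθ h0 hk, ← rate_mul_shiftedTime_mul_add hθ h0 hk,
      ← rate_mul_shiftedTime hθ h0 hk]
    ext i
    fin_cases i <;> simp <;> ring

lemma hasFDerivAt_surv (hθ : θ ∈ paramSpace) {j : ℕ} (hj : j ≤ S.L + 1) :
    HasFDerivAt (fun η ↦ S.surv η j) (-dotCLM (S.z θ j)) θ := by
  by_cases h : j ≤ S.L
  · simp only [surv, if_pos h, z_eq hθ h]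
    refine (hasFDerivAt_cumHazard hθ (S.t j)).neg.exp.congr_fderiv ?_
    ext u
    simp [dotCLM]
    ring
  · obtain rfl : j = S.L + 1 := by omega
    simp only [surv, if_neg h, z]
    refine (hasFDerivAt_const (0 : ℝ) θ).congr_fderiv ?_
    ext u
    simp [dotCLM]

lemma isOpen_paramSpace : IsOpen paramSpace :=
  isOpen_lt continuous_const (continuous_apply 0)

lemma W_mulVec_apply (u : Fin 2 → ℝ) (c : Fin (S.L + 1)) :
    (S.W θ *ᵥ u) c = S.z θ (c + 1) ⬝ᵥ u - S.z θ c ⬝ᵥ u := by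
  rw [← sub_dotProduct]; rfl

lemma hasFDerivAt_cellProb (hθ : θ ∈ paramSpace) (c : Fin (S.L + 1)) :
    HasFDerivAt (fun η ↦ S.cellProb η c) (dotCLM (S.W θ c)) θ := by
  have h := (hasFDerivAt_surv (S := S) hθ (Nat.le_succ_of_le c.is_le)).sub
    (hasFDerivAt_surv (S := S) hθ (Nat.succ_le_of_lt c.2))
  refine (h.congr_fderiv ?_).congr_of_eventuallyEq ?_
  · ext u
    simp [dotCLM, W]
    ring
  · filter_upwards [isOpen_paramSpace.mem_nhds hθ] with η hη using cellProb_eq_surv_sub hη c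

lemma hasFDerivAt_cellProb_pi (hθ : θ ∈ paramSpace) :
    HasFDerivAt S.cellProb (Matrix.toLin' (S.W θ)).toContinuousLinearMap θ := by
  rw [hasFDerivAt_pi']
  refine fun c ↦ (hasFDerivAt_cellProb hθ c).congr_fderiv ?_
  ext u
  simp [dotCLM_apply, Matrix.mulVec]

lemma continuousAt_cellProb (hθ : θ ∈ paramSpace) : ContinuousAt S.cellProb θ :=
  (hasFDerivAt_cellProb_pi hθ).continuousAt

lemma continuousAt_z (hθ : θ ∈ paramSpace) {j : ℕ} (hj : j ≤ S.L + 1) :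
    ContinuousAt (fun η ↦ S.z η j) θ := by
  by_cases h : j ≤ S.L
  · have hc : ContinuousAt (fun η ↦ S.cumHazard η (S.t j)) θ :=
      (hasFDerivAt_cumHazard hθ _).continuousAt
    refine ContinuousAt.congr ?_ <| Filter.mem_of_superset (isOpen_paramSpace.mem_nhds hθ)
      fun η hη ↦ (z_eq hη h).symm
    refine (hc.neg.rexp).smul (continuousAt_pi.2 fun i ↦ ?_)
    fin_cases i
    · exact hc.div (continuous_apply 0).continuousAt (ne_of_gt hθ)
    · have hs : ContinuousAt (fun η ↦ ∑ r ∈ Finset.Icc 1 S.k,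
          S.exposure (S.t j) r * (S.rate η r * S.x r)) θ :=
        tendsto_finsetSum _ fun r _ ↦
          ((hasFDerivAt_rate hθ r).continuousAt.mul_const (S.x r)).const_mul (S.exposure (S.t j) r)
      exact hs
  · obtain rfl : j = S.L + 1 := by omega
    simp only [z, or_true, if_true]
    exact continuousAt_const

lemma continuousAt_W (hθ : θ ∈ paramSpace) : ContinuousAt S.W θ := by
  refine continuousAt_pi.2 fun c ↦ ?_
  exact (continuousAt_z hθ (Nat.succ_le_of_lt c.2)).sub
    (continuousAt_z hθ (Nat.le_succ_of_le c.is_le))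

lemma sum_W_mulVec (u : Fin 2 → ℝ) : ∑ c, (S.W θ *ᵥ u) c = 0 := by
  simp only [W_mulVec_apply]
  rw [Fin.sum_univ_eq_sum_range (fun i ↦ S.z θ (i + 1) ⬝ᵥ u - S.z θ i ⬝ᵥ u),
    Finset.sum_range_sub (fun i ↦ S.z θ i ⬝ᵥ u)]
  simp [z]

lemma sum_exposure_τ_mul {i : ℕ} (hi : i ≤ S.k) (f : ℕ → ℝ) :
    ∑ r ∈ Finset.Icc 1 S.k, S.exposure (S.τ i) r * f r =
      ∑ r ∈ Finset.Icc 1 i, (S.τ r - S.τ (r - 1)) * f r := by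
  have hτ := S.τ_strictMonoOn.monotoneOn
  rw [← Finset.sum_subset (Finset.Icc_subset_Icc le_rfl hi)]
  · refine Finset.sum_congr rfl fun r hr ↦ ?_
    rw [Finset.mem_Icc] at hr
    rw [exposure, min_eq_right (hτ (show r ≤ S.k by omega) hi hr.2),
      min_eq_right (hτ (show r - 1 ≤ S.k by omega) hi (by omega))]
  · intro r hr hr'
    simp only [Finset.mem_Icc] at hr hr'
    rw [exposure, min_eq_left (hτ hi hr.2 (by omega)),
      min_eq_left (hτ hi (show r - 1 ≤ S.k by omega) (by omega)), sub_self, zero_mul]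

lemma sum_exposure_τ_one_mul (f : ℕ → ℝ) :
    ∑ r ∈ Finset.Icc 1 S.k, S.exposure (S.τ 1) r * f r = S.τ 1 * f 1 := by
  rw [sum_exposure_τ_mul (by have := S.two_le_k; omega)]
  simp [τ_zero]

lemma sum_exposure_τ_two_mul (f : ℕ → ℝ) :
    ∑ r ∈ Finset.Icc 1 S.k, S.exposure (S.τ 2) r * f r =
      S.τ 1 * f 1 + (S.τ 2 - S.τ 1) * f 2 := by
  rw [sum_exposure_τ_mul S.two_le_k, Finset.sum_Icc_succ_top (by norm_num)]
  simp [τ_zero]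

lemma τ_one_pos : 0 < S.τ 1 := by
  have := S.two_le_k
  exact S.τ_zero ▸ S.τ_strictMonoOn (Nat.zero_le _) (show 1 ≤ S.k by omega) one_pos

lemma τ_one_lt_τ_two : S.τ 1 < S.τ 2 := by
  have := S.two_le_k
  exact S.τ_strictMonoOn (show 1 ≤ S.k by omega) S.two_le_k one_lt_two

/-- `W` has full column rank: the gradients of the cumulative hazards at `τ 1` and `τ 2` are
linearly independent because `x 1 ≠ x 2`. -/
lemma eq_zero_of_W_mulVec_eq_zero (hθ : θ ∈ paramSpace) {u : Fin 2 → ℝ}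
    (hu : S.W θ *ᵥ u = 0) : u = 0 := by
  have hk := S.two_le_k
  have hz (j : ℕ) (hj : j ≤ S.L) : S.z θ j ⬝ᵥ u = 0 := by
    induction j with
    | zero => simp [z]
    | succ j ih =>
      have h := congrFun hu ⟨j, by omega⟩
      rw [W_mulVec_apply, ih (by omega), sub_zero] at h
      exact h
  have hsum (j : ℕ) (hj : j ≤ S.L) : ∑ r ∈ Finset.Icc 1 S.k, S.exposure (S.t j) r *
      (S.rate θ r * (u 0 / θ 0 + S.x r * u 1)) = 0 := by
    have h := hz j hj
    rw [z_eq hθ hj, smul_dotProduct, smul_eq_mul] at h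
    have h := (mul_eq_zero.1 h).resolve_left (Real.exp_pos _).ne'
    rw [← h]
    simp only [dotProduct, Fin.sum_univ_two, cumHazard, cons_val_zero, cons_val_one,
      Finset.sum_mul, Finset.sum_div, ← Finset.sum_add_distrib]
    exact Finset.sum_congr rfl fun r _ ↦ by ring
  have h1 := hsum _ (S.l_le (show 1 ≤ S.k by omega))
  have h2 := hsum _ (S.l_le hk)
  change ∑ r ∈ Finset.Icc 1 S.k, S.exposure (S.τ 1) r * _ = 0 at h1
  change ∑ r ∈ Finset.Icc 1 S.k, S.exposure (S.τ 2) r * _ = 0 at h2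
  rw [sum_exposure_τ_one_mul] at h1
  rw [sum_exposure_τ_two_mul, h1, zero_add] at h2
  have e1 : u 0 / θ 0 + S.x 1 * u 1 = 0 :=
    (mul_eq_zero.1 ((mul_eq_zero.1 h1).resolve_left τ_one_pos.ne')).resolve_left (rate_pos hθ 1).ne'
  have e2 : u 0 / θ 0 + S.x 2 * u 1 = 0 :=
    (mul_eq_zero.1 ((mul_eq_zero.1 h2).resolve_left (sub_pos.2 τ_one_lt_τ_two).ne')).resolve_left
      (rate_pos hθ 2).ne'
  have hx : S.x 1 < S.x 2 := S.x_lt 1 le_rfl (by omega)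
  have hu1 : u 1 = 0 := by
    have : (S.x 2 - S.x 1) * u 1 = 0 := by linarith
    exact (mul_eq_zero.1 this).resolve_left (sub_pos.2 hx).ne'
  have hu0 : u 0 = 0 := by
    rw [hu1, mul_zero, add_zero] at e1
    exact (div_eq_zero_iff.1 e1).resolve_right (ne_of_gt hθ)
  ext i
  fin_cases i
  exacts [hu0, hu1]

/-- The parameter is a continuous function of the cell probabilities: the survival probabilities
at `τ 1` and `τ 2` determine the two lowest failure rates, hence `θ`. -/
lemma exists_continuousAt_leftInverse_cellProb (hθ : θ ∈ paramSpace) :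
    ∃ g : (Fin (S.L + 1) → ℝ) → Fin 2 → ℝ, ContinuousAt g (S.cellProb θ) ∧
      ∀ η ∈ paramSpace, g (S.cellProb η) = η := by
  have hk := S.two_le_k
  have hx : S.x 1 < S.x 2 := S.x_lt 1 le_rfl (by omega)
  let σ (q : Fin (S.L + 1) → ℝ) (i : ℕ) : ℝ :=
    1 - ∑ c : Fin (S.L + 1), if (c : ℕ) < S.l i then q c else 0
  let r₁ (q : Fin (S.L + 1) → ℝ) : ℝ := -Real.log (σ q 1) / S.τ 1
  let r₂ (q : Fin (S.L + 1) → ℝ) : ℝ :=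
    (-Real.log (σ q 2) + Real.log (σ q 1)) / (S.τ 2 - S.τ 1)
  let b (q : Fin (S.L + 1) → ℝ) : ℝ := Real.log (r₂ q / r₁ q) / (S.x 2 - S.x 1)
  have hσ (η) (hη : η ∈ paramSpace) (i : ℕ) (hi : i ≤ S.k) :
      σ (S.cellProb η) i = Real.exp (-S.cumHazard η (S.τ i)) := by
    simp only [σ]
    rw [sum_cellProb_lt hη _ ((S.l_le hi).trans (Nat.le_succ _)), sub_sub_cancel, surv,
      if_pos (S.l_le hi), τ]
  have hr₁ (η) (hη : η ∈ paramSpace) : r₁ (S.cellProb η) = S.rate η 1 := by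
    simp only [r₁]
    rw [hσ η hη 1 (by omega), Real.log_exp, neg_neg, cumHazard, sum_exposure_τ_one_mul,
      mul_div_cancel_left₀ _ τ_one_pos.ne']
  have hr₂ (η) (hη : η ∈ paramSpace) : r₂ (S.cellProb η) = S.rate η 2 := by
    simp only [r₂]
    rw [hσ η hη 1 (by omega), hσ η hη 2 hk, Real.log_exp, Real.log_exp, neg_neg, cumHazard,
      cumHazard, sum_exposure_τ_one_mul, sum_exposure_τ_two_mul, add_neg_cancel_comm,
      mul_div_cancel_left₀ _ (sub_pos.2 τ_one_lt_τ_two).ne']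
  have hb (η) (hη : η ∈ paramSpace) : b (S.cellProb η) = η 1 := by
    have h0 : η 0 ≠ 0 := ne_of_gt hη
    simp only [b]
    rw [hr₁ η hη, hr₂ η hη, rate, rate, mul_div_mul_left _ _ h0, ← Real.exp_sub, Real.log_exp,
      ← mul_sub, mul_div_cancel_right₀ _ (sub_pos.2 hx).ne']
  have cσ (i : ℕ) : Continuous fun q ↦ σ q i := by
    refine continuous_const.sub (continuous_finsetSum _ fun c _ ↦ ?_)
    split_ifs <;> fun_prop
  have clog (i : ℕ) (hi : i ≤ S.k) : ContinuousAt (fun q ↦ Real.log (σ q i)) (S.cellProb θ) :=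
    (cσ i).continuousAt.log (by rw [hσ θ hθ i hi]; exact (Real.exp_pos _).ne')
  have c₁ : ContinuousAt r₁ (S.cellProb θ) := (clog 1 (by omega)).neg.div_const _
  have c₂ : ContinuousAt r₂ (S.cellProb θ) :=
    ((clog 2 hk).neg.add (clog 1 (by omega))).div_const _
  have p₁ := rate_pos (S := S) hθ 1
  have p₂ := rate_pos (S := S) hθ 2
  have cb : ContinuousAt b (S.cellProb θ) := by
    refine ContinuousAt.div_const (ContinuousAt.log (c₂.div c₁ ?_) ?_) _
    · rw [hr₁ θ hθ]; exact p₁.ne'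
    · change r₂ (S.cellProb θ) / r₁ (S.cellProb θ) ≠ 0
      rw [hr₁ θ hθ, hr₂ θ hθ]; exact (div_pos p₂ p₁).ne'
  refine ⟨fun q ↦ ![r₁ q * Real.exp (-(b q * S.x 1)), b q], continuousAt_pi.2 fun i ↦ ?_,
    fun η hη ↦ ?_⟩
  · fin_cases i
    · exact c₁.mul (cb.mul_const _).neg.rexp
    · exact cb
  · ext i
    fin_cases i
    · simp [hr₁ η hη, hb η hη, rate, mul_assoc, ← Real.exp_add]
    · simp [hb η hη]

end StepStressPlan

/-! ### The density power divergence -/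

section Divergence

/-- One summand of the density power divergence; for `β = 0` the linear term `b - a`, which sums
to zero over probability vectors, makes it nonnegative. -/
noncomputable def divTerm (β a b : ℝ) : ℝ :=
  if β = 0 then a * Real.log (a / b) + (b - a)
  else b ^ (1 + β) - (1 + 1 / β) * a * b ^ β + 1 / β * a ^ (β + 1)

variable {ι : Type*} [Fintype ι] {β : ℝ}

lemma densityPowerDivergence_eq_sum_divTerm (β : ℝ) {p q : ι → ℝ} (hp : ∑ j, p j = 1)
    (hq : ∑ j, q j = 1) : densityPowerDivergence β p q = ∑ j, divTerm β (p j) (q j) := by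
  unfold densityPowerDivergence divTerm
  split_ifs
  · rw [Finset.sum_add_distrib, Finset.sum_sub_distrib, hp, hq, sub_self, add_zero]
  · rfl

lemma divTerm_self (hβ : 0 ≤ β) {a : ℝ} (ha : 0 ≤ a) : divTerm β a a = 0 := by
  unfold divTerm
  split_ifs with h
  · rcases ha.eq_or_lt with rfl | h'
    · simp
    · simp [h'.ne']
  · rw [add_comm β 1, Real.rpow_add' ha (by positivity), Real.rpow_one]
    ring

/-- The Kullback–Leibler term dominates the Hellinger term. -/
lemma sq_sqrt_sub_sqrt_le_divTerm_zero {a b : ℝ} (ha : 0 ≤ a) (hb : 0 < b) :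
    (√a - √b) ^ 2 ≤ divTerm 0 a b := by
  rw [divTerm, if_pos rfl]
  rcases ha.eq_or_lt with rfl | ha
  · simp [Real.sq_sqrt hb.le]
  have hsa := Real.sqrt_pos.2 ha
  have hsb := Real.sqrt_pos.2 hb
  have h := Real.log_le_sub_one_of_pos (div_pos hsb hsa)
  have hl : Real.log (a / b) = -2 * Real.log (√b / √a) := by
    rw [Real.log_div ha.ne' hb.ne', Real.log_div hsb.ne' hsa.ne', Real.log_sqrt ha.le,
      Real.log_sqrt hb.le]
    ring
  have hm : a * (√b / √a) = √a * √b := by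
    nth_rw 1 [← Real.mul_self_sqrt ha.le]
    field_simp
  have h2 := mul_le_mul_of_nonneg_left h ha.le
  rw [mul_sub, hm, mul_one] at h2
  rw [hl, sub_sq, Real.sq_sqrt ha.le, Real.sq_sqrt hb.le]
  linarith

/-- Strict convexity of `x ↦ x ^ (1 + β)`, in the form of Bernoulli's inequality. -/
lemma divTerm_pos (hβ : 0 < β) {a b : ℝ} (ha : 0 ≤ a) (hb : 0 ≤ b) (hab : a ≠ b) :
    0 < divTerm β a b := by
  rw [divTerm, if_neg hβ.ne']
  rcases hb.eq_or_lt with rfl | hb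
  · have : 0 < a ^ (β + 1) := Real.rpow_pos_of_pos (lt_of_le_of_ne ha hab.symm) _
    rw [Real.zero_rpow (by positivity), Real.zero_rpow hβ.ne', mul_zero, sub_zero, zero_add]
    positivity
  · have h := one_add_mul_self_lt_rpow_one_add (s := a / b - 1) (p := β + 1)
      (by linarith [div_nonneg ha hb.le]) (by rw [sub_ne_zero, Ne, div_eq_one_iff_eq hb.ne']; exact hab)
      (by linarith)
    rw [add_sub_cancel, Real.div_rpow ha hb.le, lt_div_iff₀ (by positivity)] at h
    have e : b ^ (β + 1) = b ^ β * b := by rw [Real.rpow_add_one hb.ne']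
    have e' : (1 + (β + 1) * (a / b - 1)) * b ^ (β + 1) = (β + 1) * a * b ^ β - β * b ^ (β + 1) := by
      rw [e]; field_simp; ring
    rw [e'] at h
    have : b ^ (1 + β) - (1 + 1 / β) * a * b ^ β + 1 / β * a ^ (β + 1) =
        1 / β * (a ^ (β + 1) - ((β + 1) * a * b ^ β - β * b ^ (β + 1))) := by
      rw [add_comm 1 β]; field_simp; ring
    rw [this]
    have := sub_pos.2 h
    positivity

lemma divTerm_nonneg (hβ : 0 ≤ β) {a b : ℝ} (ha : 0 ≤ a) (hb : 0 < b) : 0 ≤ divTerm β a b := by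
  rcases eq_or_ne a b with rfl | hab
  · exact (divTerm_self hβ ha).ge
  rcases hβ.eq_or_lt with rfl | hβ
  · exact (sq_nonneg _).trans (sq_sqrt_sub_sqrt_le_divTerm_zero ha hb)
  · exact (divTerm_pos hβ ha hb.le hab).le

/-- On the unit square the divergence term is bounded away from zero off the diagonal. -/
lemma exists_le_divTerm (hβ : 0 ≤ β) {ε : ℝ} (hε : 0 < ε) :
    ∃ η > 0, ∀ a b : ℝ, 0 ≤ a → a ≤ 1 → 0 < b → b ≤ 1 → ε ≤ |a - b| → η ≤ divTerm β a b := by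
  rcases hβ.eq_or_lt with rfl | hβ
  · refine ⟨(ε / 2) ^ 2, by positivity, fun a b ha ha1 hb hb1 hab ↦
      le_trans ?_ (sq_sqrt_sub_sqrt_le_divTerm_zero ha hb)⟩
    have h1 : |a - b| = |√a - √b| * (√a + √b) := by
      rw [← abs_of_nonneg (a := √a + √b) (by positivity), ← abs_mul]
      congr 1
      nlinarith [Real.mul_self_sqrt ha, Real.mul_self_sqrt hb.le]
    have h2 : √a + √b ≤ 2 := by
      have := Real.sqrt_le_one.2 ha1
      have := Real.sqrt_le_one.2 hb1
      linarith
    rw [← sq_abs (√a - √b)]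
    have : ε / 2 ≤ |√a - √b| := by nlinarith [abs_nonneg (√a - √b)]
    gcongr
  · let K : Set (ℝ × ℝ) := (Set.Icc 0 1 ×ˢ Set.Icc 0 1) ∩ {x | ε ≤ |x.1 - x.2|}
    have hK : IsCompact K := (isCompact_Icc.prod isCompact_Icc).inter_right
      (isClosed_le continuous_const (by fun_prop))
    have hc : Continuous fun x : ℝ × ℝ ↦ divTerm β x.1 x.2 := by
      simp only [divTerm, if_neg hβ.ne']
      have c1 : Continuous fun x : ℝ × ℝ ↦ x.2 ^ (1 + β) :=
        (Real.continuous_rpow_const (by positivity)).comp continuous_snd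
      have c2 : Continuous fun x : ℝ × ℝ ↦ x.2 ^ β :=
        (Real.continuous_rpow_const (by positivity)).comp continuous_snd
      have c3 : Continuous fun x : ℝ × ℝ ↦ x.1 ^ (β + 1) :=
        (Real.continuous_rpow_const (by positivity)).comp continuous_fst
      fun_prop
    rcases K.eq_empty_or_nonempty with h | h
    · exact ⟨1, one_pos, fun a b ha ha1 hb hb1 hab ↦
        absurd (show (a, b) ∈ K from ⟨⟨⟨ha, ha1⟩, hb.le, hb1⟩, hab⟩) (h ▸ Set.notMem_empty _)⟩
    · obtain ⟨x, hx, hmin⟩ := hK.exists_isMinOn h hc.continuousOn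
      refine ⟨divTerm β x.1 x.2, divTerm_pos hβ hx.1.1.1 hx.1.2.1 fun he ↦ ?_,
        fun a b ha ha1 hb hb1 hab ↦ hmin (show (a, b) ∈ K from ⟨⟨⟨ha, ha1⟩, hb.le, hb1⟩, hab⟩)⟩
      have := hx.2
      simp only [Set.mem_ofPred_eq, he, sub_self, abs_zero] at this
      exact this.not_gt hε

lemma le_one_of_sum_eq_one {p : ι → ℝ} (hp : p ∈ stdSimplex ℝ ι) (j : ι) : p j ≤ 1 :=
  hp.2 ▸ Finset.single_le_sum (fun i _ ↦ hp.1 i) (Finset.mem_univ j)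

/-- The density power divergence separates probability vectors uniformly. -/
lemma exists_le_densityPowerDivergence (hβ : 0 ≤ β) {ε : ℝ} (hε : 0 < ε) :
    ∃ η > 0, ∀ p q : ι → ℝ, p ∈ stdSimplex ℝ ι → q ∈ stdSimplex ℝ ι → (∀ j, 0 < q j) →
      ε ≤ dist p q → η ≤ densityPowerDivergence β p q := by
  obtain ⟨η, hη, h⟩ := exists_le_divTerm hβ hε
  refine ⟨η, hη, fun p q hp hq hpos hpq ↦ ?_⟩
  obtain ⟨j, hj⟩ : ∃ j, ε ≤ dist (p j) (q j) := by
    by_contra! hc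
    exact hpq.not_gt ((dist_pi_lt_iff hε).2 hc)
  rw [densityPowerDivergence_eq_sum_divTerm β hp.2 hq.2]
  exact (h _ _ (hp.1 j) (le_one_of_sum_eq_one hp j) (hpos j) (le_one_of_sum_eq_one hq j) hj).trans
    (Finset.single_le_sum (f := fun j ↦ divTerm β (p j) (q j))
      (fun i _ ↦ divTerm_nonneg hβ (hp.1 i) (hpos i)) (Finset.mem_univ j))

lemma continuousAt_densityPowerDivergence_left (β : ℝ) {q : ι → ℝ} (hq : ∀ j, 0 < q j) :
    ContinuousAt (fun p ↦ densityPowerDivergence β p q) q := by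
  unfold densityPowerDivergence
  split_ifs with h
  · refine tendsto_finsetSum _ fun j _ ↦ ?_
    have hc : ContinuousAt (fun p : ι → ℝ ↦ p j) q := (continuous_apply j).continuousAt
    exact hc.mul ((hc.div_const _).log (div_pos (hq j) (hq j)).ne')
  · refine tendsto_finsetSum _ fun j _ ↦ ?_
    have hc : ContinuousAt (fun p : ι → ℝ ↦ p j) q := (continuous_apply j).continuousAt
    exact ((hc.const_mul _).mul_const _).const_sub _ |>.add
      ((hc.rpow_const (.inl (hq j).ne')).const_mul _)

lemma densityPowerDivergence_self (hβ : 0 ≤ β) {q : ι → ℝ} (hq : q ∈ stdSimplex ℝ ι) :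
    densityPowerDivergence β q q = 0 := by
  rw [densityPowerDivergence_eq_sum_divTerm β hq.2 hq.2]
  exact Finset.sum_eq_zero fun j _ ↦ divTerm_self hβ (hq.1 j)

/-- The derivative of a divergence term in the second argument; thanks to the linear term
`b - a` at `β = 0` it has the same form for all `β`. -/
lemma hasDerivAt_divTerm {a b : ℝ} (ha : 0 ≤ a) (hb : 0 < b) :
    HasDerivAt (divTerm β a) ((1 + β) * (b ^ (β - 1) * (b - a))) b := by
  unfold divTerm
  split_ifs with h
  · subst h
    rcases ha.eq_or_lt with rfl | ha
    · simp only [zero_mul, zero_add, sub_zero]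
      refine (hasDerivAt_id b).congr_deriv ?_
      rw [zero_sub, Real.rpow_neg_one, inv_mul_cancel₀ hb.ne', add_zero, mul_one]
    · have h1 : HasDerivAt (fun y ↦ a / y) (-(a / b ^ 2)) b := by
        simpa [div_eq_mul_inv] using (hasDerivAt_inv hb.ne').const_mul a
      refine (((h1.log (div_pos ha hb).ne').const_mul a).add
        ((hasDerivAt_id b).sub_const a)).congr_deriv ?_
      rw [zero_sub, Real.rpow_neg_one]
      field_simp
      ring
  · have h1 := Real.hasDerivAt_rpow_const (x := b) (p := 1 + β) (.inl hb.ne')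
    have h2 := Real.hasDerivAt_rpow_const (x := b) (p := β) (.inl hb.ne')
    refine ((h1.sub (h2.const_mul ((1 + 1 / β) * a))).add_const _).congr_deriv ?_
    have e : b ^ β = b ^ (β - 1) * b := by rw [← Real.rpow_add_one hb.ne', sub_add_cancel]
    rw [add_sub_cancel_left, e]
    field_simp
    ring

end Divergence

open Asymptotics in
lemma isLittleO_mulVec {α m n : Type*} [Fintype m] [Fintype n] {l : Filter α}
    {M : α → Matrix m n ℝ} (hM : Tendsto M l (𝓝 0)) (v : α → n → ℝ) :
    (fun x ↦ M x *ᵥ v x) =o[l] v := by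
  refine isLittleO_pi.2 fun i ↦ ?_
  refine IsLittleO.fun_sum fun j _ ↦ ?_
  have h1 : (fun x ↦ M x i j) =o[l] fun _ ↦ (1 : ℝ) :=
    (isLittleO_one_iff ℝ).2 ((tendsto_pi_nhds.1 ((tendsto_pi_nhds.1 hM) i)) j)
  have h2 : (fun x ↦ v x j) =O[l] v := isBigO_pi.1 (isBigO_refl v l) j
  simpa using h1.mul_isBigO h2.norm_right

open Asymptotics in
lemma isBigO_mulVec {α m n : Type*} [Fintype m] [Fintype n] {l : Filter α}
    (M : Matrix m n ℝ) (v : α → n → ℝ) : (fun x ↦ M *ᵥ v x) =O[l] v :=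
  isBigO_pi.2 fun i ↦ IsBigO.fun_sum fun j _ ↦
    (isBigO_pi.1 (isBigO_refl v l) j).const_mul_left (M i j)

lemma ContinuousAt.matrix_mul' {X l m n : Type*} [TopologicalSpace X] [Fintype m]
    {A : X → Matrix l m ℝ} {B : X → Matrix m n ℝ} {x : X} (hA : ContinuousAt A x)
    (hB : ContinuousAt B x) : ContinuousAt (fun y ↦ A y * B y) x :=
  ((continuous_fst.matrix_mul continuous_snd).continuousAt (x := (A x, B x))).comp₂ hA hB

/-! ### The matrices `J_β` and `K_β` -/

namespace StepStressPlan

variable {S : StepStressPlan} {θ : Fin 2 → ℝ} {β : ℝ}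

lemma cellProb_mem_stdSimplex (hθ : θ ∈ paramSpace) :
    S.cellProb θ ∈ stdSimplex ℝ (Fin (S.L + 1)) :=
  ⟨fun c ↦ (cellProb_pos hθ c).le, sum_cellProb hθ⟩

variable (S) in
/-- The matrix `Wᵀ D_π^{β-1}` of the estimating equations `Wᵀ D_π^{β-1} (π(θ) - p) = 0`. -/
noncomputable def scoreMatrix (β : ℝ) (θ : Fin 2 → ℝ) : Matrix (Fin 2) (Fin (S.L + 1)) ℝ :=
  (S.W θ)ᵀ * diagonal (fun c => S.cellProb θ c ^ (β - 1))

lemma J_eq_scoreMatrix_mul : S.J β θ = S.scoreMatrix β θ * S.W θ := rfl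

lemma continuousAt_cellProb_rpow (hθ : θ ∈ paramSpace) (s : ℝ) (c : Fin (S.L + 1)) :
    ContinuousAt (fun η ↦ S.cellProb η c ^ s) θ :=
  ContinuousAt.rpow_const (continuousAt_pi.1 (continuousAt_cellProb hθ) c)
    (.inl (cellProb_pos hθ c).ne')

lemma continuousAt_diagonal_cellProb_rpow (hθ : θ ∈ paramSpace) (s : ℝ) :
    ContinuousAt (fun η ↦ diagonal fun c ↦ S.cellProb η c ^ s) θ :=
  (continuous_id.matrix_diagonal).continuousAt.comp
    (continuousAt_pi.2 fun c ↦ continuousAt_cellProb_rpow hθ s c)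

lemma continuousAt_transpose_W (hθ : θ ∈ paramSpace) : ContinuousAt (fun η ↦ (S.W η)ᵀ) θ :=
  (continuous_id.matrix_transpose).continuousAt.comp (continuousAt_W hθ)

lemma continuousAt_scoreMatrix (hθ : θ ∈ paramSpace) (β : ℝ) :
    ContinuousAt (S.scoreMatrix β) θ :=
  (continuousAt_transpose_W hθ).matrix_mul' (continuousAt_diagonal_cellProb_rpow hθ _)

lemma continuousAt_J (hθ : θ ∈ paramSpace) (β : ℝ) : ContinuousAt (S.J β) θ :=
  (continuousAt_scoreMatrix hθ β).matrix_mul' (continuousAt_W hθ)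

lemma continuousAt_K (hθ : θ ∈ paramSpace) (β : ℝ) : ContinuousAt (S.K β) θ := by
  refine ((continuousAt_transpose_W hθ).matrix_mul' ((continuousAt_diagonal_cellProb_rpow hθ _).sub
    ?_)).matrix_mul' (continuousAt_W hθ)
  refine continuousAt_pi.2 fun c ↦ continuousAt_pi.2 fun c' ↦ ?_
  exact (continuousAt_cellProb_rpow hθ β c).mul (continuousAt_cellProb_rpow hθ β c')

lemma dotProduct_J_mulVec (u : Fin 2 → ℝ) :
    u ⬝ᵥ S.J β θ *ᵥ u = ∑ c, S.cellProb θ c ^ (β - 1) * ((S.W θ *ᵥ u) c) ^ 2 := by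
  rw [J, ← mulVec_mulVec, ← mulVec_mulVec, dotProduct_mulVec, vecMul_transpose, dotProduct]
  refine Finset.sum_congr rfl fun c _ ↦ ?_
  rw [mulVec_diagonal]
  ring

lemma J_transpose : (S.J β θ)ᵀ = S.J β θ := by
  simp [J, transpose_mul, Matrix.mul_assoc]

lemma isUnit_det_J (hθ : θ ∈ paramSpace) : IsUnit (S.J β θ).det := by
  rw [isUnit_iff_ne_zero]
  intro h
  obtain ⟨u, hu, hJu⟩ := exists_mulVec_eq_zero_iff.2 h
  refine hu (eq_zero_of_W_mulVec_eq_zero (S := S) hθ ?_)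
  have h0 := dotProduct_J_mulVec (S := S) (θ := θ) (β := β) u
  rw [hJu, dotProduct_zero, eq_comm, Finset.sum_eq_zero_iff_of_nonneg fun c _ ↦
    mul_nonneg (Real.rpow_nonneg (cellProb_pos hθ c).le _) (sq_nonneg _)] at h0
  ext c
  exact pow_eq_zero_iff two_ne_zero |>.1
    ((mul_eq_zero.1 (h0 c (Finset.mem_univ c))).resolve_left
      (Real.rpow_pos_of_pos (cellProb_pos hθ c) _).ne')

lemma continuousAt_J_inv (hθ : θ ∈ paramSpace) (β : ℝ) :
    ContinuousAt (fun η ↦ (S.J β η)⁻¹) θ := by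
  have hJ := continuousAt_J (S := S) hθ β
  have hdet : ContinuousAt (fun η ↦ (S.J β η).det) θ :=
    (continuous_id.matrix_det).continuousAt.comp hJ
  have hadj : ContinuousAt (fun η ↦ (S.J β η).adjugate) θ :=
    (continuous_id.matrix_adjugate).continuousAt.comp hJ
  simp only [inv_def, Ring.inverse_eq_inv']
  exact (hdet.inv₀ (isUnit_det_J hθ).ne_zero).smul hadj

variable (S) in
/-- The asymptotic variance `mᵀ J_β⁻¹ K_β J_β⁻¹ m` of `√N mᵀ θ̂`. -/
noncomputable def asymptoticVariance (β : ℝ) (m θ : Fin 2 → ℝ) : ℝ :=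
  m ⬝ᵥ (((S.J β θ)⁻¹ * S.K β θ * (S.J β θ)⁻¹) *ᵥ m)

lemma continuousAt_asymptoticVariance (hθ : θ ∈ paramSpace) (β : ℝ) (m : Fin 2 → ℝ) :
    ContinuousAt (S.asymptoticVariance β m) θ := by
  have h := ((continuousAt_J_inv (S := S) hθ β).matrix_mul' (continuousAt_K (S := S) hθ β)).matrix_mul'
    (continuousAt_J_inv (S := S) hθ β)
  exact ((continuous_const (y := m)).dotProduct
    (continuous_id.matrix_mulVec continuous_const)).continuousAt.comp h

/-- The quadratic form of `K_β` is the variance of `c ↦ π_c^{β-1} (W u)_c` under `π(θ)`. -/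
lemma dotProduct_K_mulVec (hθ : θ ∈ paramSpace) (u : Fin 2 → ℝ) :
    u ⬝ᵥ S.K β θ *ᵥ u =
      ∑ c, S.cellProb θ c * (S.cellProb θ c ^ (β - 1) * (S.W θ *ᵥ u) c) ^ 2 -
        (∑ c, S.cellProb θ c * (S.cellProb θ c ^ (β - 1) * (S.W θ *ᵥ u) c)) ^ 2 := by
  rw [K, ← mulVec_mulVec, ← mulVec_mulVec, dotProduct_mulVec, vecMul_transpose, sub_mulVec,
    dotProduct_sub, vecMulVec_mulVec]
  have hp (c) := cellProb_pos (S := S) hθ c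
  have e1 (c) : S.cellProb θ c ^ β = S.cellProb θ c * S.cellProb θ c ^ (β - 1) := by
    rw [mul_comm, ← Real.rpow_add_one (hp c).ne', sub_add_cancel]
  have e2 (c) : S.cellProb θ c ^ (2 * β - 1) =
      S.cellProb θ c * (S.cellProb θ c ^ (β - 1)) ^ 2 := by
    rw [pow_two, ← mul_assoc, ← e1, ← Real.rpow_add (hp c)]
    congr 1
    ring
  congr 1
  · refine Finset.sum_congr rfl fun c _ ↦ ?_
    rw [mulVec_diagonal, e2]
    ring
  · rw [op_smul_eq_smul, dotProduct_smul, smul_eq_mul, pow_two]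
    simp only [dotProduct, e1]
    congr 1 <;> exact Finset.sum_congr rfl fun c _ ↦ by ring

/-- `K_β` is positive definite: a vanishing variance would make `π_c^{β-1} (W u)_c` constant in
`c`, and since the rows of `W` sum to zero this constant is zero. -/
lemma dotProduct_K_mulVec_pos (hθ : θ ∈ paramSpace) {u : Fin 2 → ℝ} (hu : u ≠ 0) :
    0 < u ⬝ᵥ S.K β θ *ᵥ u := by
  rw [dotProduct_K_mulVec hθ]
  set a : Fin (S.L + 1) → ℝ := fun c ↦ S.cellProb θ c ^ (β - 1) * (S.W θ *ᵥ u) c with ha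
  have hp (c) := cellProb_pos (S := S) hθ c
  set μ := ∑ c, S.cellProb θ c * a c with hμ
  have hvar : ∑ c, S.cellProb θ c * a c ^ 2 - μ ^ 2 = ∑ c, S.cellProb θ c * (a c - μ) ^ 2 := by
    have h (c : Fin (S.L + 1)) : S.cellProb θ c * (a c - μ) ^ 2 = S.cellProb θ c * a c ^ 2 -
      2 * μ * (S.cellProb θ c * a c) + μ ^ 2 * S.cellProb θ c := by ring
    simp only [h, Finset.sum_add_distrib, Finset.sum_sub_distrib, ← Finset.mul_sum,
      sum_cellProb hθ, ← hμ]
    ring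
  rw [hvar]
  have hnn : ∀ c ∈ Finset.univ, 0 ≤ S.cellProb θ c * (a c - μ) ^ 2 := fun c _ ↦
    mul_nonneg (hp c).le (sq_nonneg _)
  refine (Finset.sum_nonneg hnn).lt_of_ne' fun h0 ↦ hu ?_
  rw [Finset.sum_eq_zero_iff_of_nonneg hnn] at h0
  have hconst (c) : a c = μ := by
    have := (mul_eq_zero.1 (h0 c (Finset.mem_univ c))).resolve_left (hp c).ne'
    exact sub_eq_zero.1 (pow_eq_zero_iff two_ne_zero |>.1 this)
  have hW (c) : (S.W θ *ᵥ u) c = S.cellProb θ c ^ (1 - β) * μ := by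
    rw [← hconst c, ha]
    simp only
    rw [← mul_assoc, ← Real.rpow_add (hp c)]
    simp
  have hsum := sum_W_mulVec (S := S) (θ := θ) u
  simp only [hW, ← Finset.sum_mul] at hsum
  have hμ0 : μ = 0 := (mul_eq_zero.1 hsum).resolve_left
    (Finset.sum_pos (fun c _ ↦ Real.rpow_pos_of_pos (hp c) _) Finset.univ_nonempty).ne'
  refine eq_zero_of_W_mulVec_eq_zero (S := S) hθ ?_
  ext c
  rw [hW, hμ0, mul_zero, Pi.zero_apply]

lemma asymptoticVariance_eq (m : Fin 2 → ℝ) :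
    S.asymptoticVariance β m θ =
      ((S.J β θ)⁻¹ *ᵥ m) ⬝ᵥ S.K β θ *ᵥ ((S.J β θ)⁻¹ *ᵥ m) := by
  rw [asymptoticVariance, ← mulVec_mulVec, ← mulVec_mulVec, dotProduct_mulVec]
  congr 1
  rw [← mulVec_transpose, transpose_nonsing_inv, J_transpose]

lemma asymptoticVariance_pos (hθ : θ ∈ paramSpace) {m : Fin 2 → ℝ} (hm : m ≠ 0) :
    0 < S.asymptoticVariance β m θ := by
  rw [asymptoticVariance_eq]
  refine dotProduct_K_mulVec_pos hθ fun h ↦ hm ?_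
  have := congrArg (S.J β θ *ᵥ ·) h
  rwa [mulVec_mulVec, mul_nonsing_inv _ (isUnit_det_J hθ), one_mulVec, mulVec_zero] at this

/-! ### Existence and consistency of minimizers -/

/-- `θ` minimizes the divergence of the model from the probability vector `p`. -/
def IsDivergenceMin (S : StepStressPlan) (β : ℝ) (p : Fin (S.L + 1) → ℝ) (θ : Fin 2 → ℝ) : Prop :=
  θ ∈ paramSpace ∧ IsMinOn (fun η ↦ densityPowerDivergence β p (S.cellProb η)) paramSpace θ

lemma hasFDerivAt_divergence {p : Fin (S.L + 1) → ℝ} (hp : p ∈ stdSimplex ℝ (Fin (S.L + 1)))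
    (hθ : θ ∈ paramSpace) :
    HasFDerivAt (fun η ↦ densityPowerDivergence β p (S.cellProb η))
      (dotCLM ((1 + β) • S.scoreMatrix β θ *ᵥ (S.cellProb θ - p))) θ := by
  have h := HasFDerivAt.fun_sum (u := Finset.univ) fun c _ ↦
    (hasDerivAt_divTerm (β := β) (hp.1 c) (cellProb_pos (S := S) hθ c)).comp_hasFDerivAt θ
      (hasFDerivAt_cellProb hθ c)
  refine (h.congr_fderiv ?_).congr_of_eventuallyEq ?_
  · ext u
    simp only [_root_.sum_apply, _root_.smul_apply, dotCLM_apply,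
      smul_eq_mul, smul_dotProduct]
    rw [scoreMatrix, ← mulVec_mulVec, mulVec_transpose, ← dotProduct_mulVec, dotProduct,
      Finset.mul_sum]
    refine Finset.sum_congr rfl fun c _ ↦ ?_
    rw [mulVec_diagonal]
    simp only [mulVec, Pi.sub_apply]
    ring
  · filter_upwards [isOpen_paramSpace.mem_nhds hθ] with η hη
    exact densityPowerDivergence_eq_sum_divTerm β hp.2 (sum_cellProb hη)

/-- The estimating equations. -/
lemma IsDivergenceMin.scoreMatrix_mulVec_eq_zero (hβ : 0 ≤ β) {p : Fin (S.L + 1) → ℝ}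
    (hp : p ∈ stdSimplex ℝ (Fin (S.L + 1))) (h : S.IsDivergenceMin β p θ) :
    S.scoreMatrix β θ *ᵥ (S.cellProb θ - p) = 0 := by
  have h0 := (h.2.isLocalMin (isOpen_paramSpace.mem_nhds h.1)).hasFDerivAt_eq_zero
    (hasFDerivAt_divergence hp h.1)
  have (u : Fin 2 → ℝ) : ((1 + β) • S.scoreMatrix β θ *ᵥ (S.cellProb θ - p)) ⬝ᵥ u = 0 := by
    rw [← dotCLM_apply, h0]; rfl
  exact (smul_eq_zero.1 (dotProduct_eq_zero _ this)).resolve_left (by positivity)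

variable {θ₀ : Fin 2 → ℝ}

/-- The filter of pairs `(p, θ)` with `p` a probability vector that tends to `π(θ₀)` and `θ` a
minimizer of the divergence from `p`.  The asymptotics of the estimator are stated along it. -/
noncomputable def minFilter (S : StepStressPlan) (β : ℝ) (θ₀ : Fin 2 → ℝ) :
    Filter ((Fin (S.L + 1) → ℝ) × (Fin 2 → ℝ)) :=
  comap Prod.fst (𝓝 (S.cellProb θ₀)) ⊓
    𝓟 {x | x.1 ∈ stdSimplex ℝ (Fin (S.L + 1)) ∧ S.IsDivergenceMin β x.1 x.2}

lemma eventually_minFilter : ∀ᶠ x in S.minFilter β θ₀,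
    x.1 ∈ stdSimplex ℝ (Fin (S.L + 1)) ∧ S.IsDivergenceMin β x.1 x.2 :=
  mem_inf_of_right (mem_principal_self _)

lemma tendsto_fst_minFilter : Tendsto Prod.fst (S.minFilter β θ₀) (𝓝 (S.cellProb θ₀)) :=
  tendsto_comap.mono_left inf_le_left

lemma eventually_densityPowerDivergence_lt (hβ : 0 ≤ β) (hθ₀ : θ₀ ∈ paramSpace) {η : ℝ}
    (hη : 0 < η) :
    ∀ᶠ p in 𝓝 (S.cellProb θ₀), densityPowerDivergence β p (S.cellProb θ₀) < η := by
  refine (continuousAt_densityPowerDivergence_left β (cellProb_pos hθ₀)).eventually_lt_const ?_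
  simpa only [densityPowerDivergence_self hβ (cellProb_mem_stdSimplex hθ₀)]

/-- Consistency of the minimizers. -/
lemma tendsto_snd_minFilter (hβ : 0 ≤ β) (hθ₀ : θ₀ ∈ paramSpace) :
    Tendsto Prod.snd (S.minFilter β θ₀) (𝓝 θ₀) := by
  obtain ⟨g, hg, hgθ⟩ := exists_continuousAt_leftInverse_cellProb (S := S) hθ₀
  have hπ : Tendsto (fun x ↦ S.cellProb x.2) (S.minFilter β θ₀) (𝓝 (S.cellProb θ₀)) := by
    refine Metric.tendsto_nhds.2 fun ε hε ↦ ?_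
    obtain ⟨η, hη, h⟩ := exists_le_densityPowerDivergence (ι := Fin (S.L + 1)) hβ (half_pos hε)
    filter_upwards [eventually_minFilter,
      tendsto_fst_minFilter.eventually (eventually_densityPowerDivergence_lt hβ hθ₀ hη),
      tendsto_fst_minFilter.eventually (Metric.ball_mem_nhds _ (half_pos hε))] with x hx h1 h2
    have h3 : dist x.1 (S.cellProb x.2) < ε / 2 := by
      by_contra! hc
      exact ((h _ _ hx.1 (cellProb_mem_stdSimplex hx.2.1) (cellProb_pos hx.2.1) hc).trans
        (hx.2.2 hθ₀)).not_gt h1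
    have h4 := dist_triangle_left (S.cellProb x.2) (S.cellProb θ₀) x.1
    linarith
  have h := hg.tendsto.comp hπ
  rw [hgθ θ₀ hθ₀] at h
  refine h.congr' ?_
  filter_upwards [eventually_minFilter] with x hx using hgθ _ hx.2.1

/-- Near `π(θ₀)` minimizers exist: outside a compact neighbourhood of `θ₀` the divergence is
bounded away from zero, while its value at `θ₀` is small. -/
lemma eventually_exists_isDivergenceMin (hβ : 0 ≤ β) (hθ₀ : θ₀ ∈ paramSpace) :
    ∀ᶠ p in 𝓝 (S.cellProb θ₀), p ∈ stdSimplex ℝ (Fin (S.L + 1)) →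
      ∃ θ, S.IsDivergenceMin β p θ := by
  obtain ⟨g, hg, hgθ⟩ := exists_continuousAt_leftInverse_cellProb (S := S) hθ₀
  obtain ⟨r, hr, hball⟩ := Metric.nhds_basis_closedBall.mem_iff.1 (isOpen_paramSpace.mem_nhds hθ₀)
  have hgr : ∀ᶠ q in 𝓝 (S.cellProb θ₀), g q ∈ Metric.closedBall θ₀ r := by
    refine hg ?_
    rw [hgθ θ₀ hθ₀]
    exact Metric.closedBall_mem_nhds _ hr
  obtain ⟨ε, hε, hgε⟩ := Metric.eventually_nhds_iff.1 hgr
  obtain ⟨η, hη, h⟩ := exists_le_densityPowerDivergence (ι := Fin (S.L + 1)) hβ (half_pos hε)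
  filter_upwards [eventually_densityPowerDivergence_lt hβ hθ₀ hη,
    Metric.ball_mem_nhds _ (half_pos hε)] with p h1 h2 hp
  obtain ⟨θ, hθ, hmin⟩ := (isCompact_closedBall θ₀ r).exists_isMinOn
    ⟨θ₀, Metric.mem_closedBall_self hr.le⟩
    (f := fun η ↦ densityPowerDivergence β p (S.cellProb η)) fun η hη ↦
      (hasFDerivAt_divergence hp (hball hη)).continuousAt.continuousWithinAt
  refine ⟨θ, hball hθ, fun ζ hζ ↦ ?_⟩
  by_cases hζr : ζ ∈ Metric.closedBall θ₀ r
  · exact hmin hζr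
  · have h3 : ε ≤ dist (S.cellProb ζ) (S.cellProb θ₀) := by
      by_contra! hc
      exact hζr (hgθ ζ hζ ▸ hgε hc)
    have h4 := dist_triangle_left (S.cellProb ζ) (S.cellProb θ₀) p
    rw [Metric.mem_ball] at h2
    calc _ ≤ densityPowerDivergence β p (S.cellProb θ₀) := hmin (Metric.mem_closedBall_self hr.le)
      _ ≤ η := h1.le
      _ ≤ _ := h _ _ hp (cellProb_mem_stdSimplex hζ) (cellProb_pos hζ) (by linarith)

/-! ### Differentiability of the estimating functional -/

open Asymptotics in
/-- The minimizer is differentiable in `p` at `π(θ₀)` with derivative `J_β⁻¹ Wᵀ D_π^{β-1}`. -/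
lemma minimizer_sub_isLittleO (hβ : 0 ≤ β) (hθ₀ : θ₀ ∈ paramSpace) :
    (fun x : (Fin (S.L + 1) → ℝ) × (Fin 2 → ℝ) ↦ x.2 - θ₀ -
        ((S.J β θ₀)⁻¹ * S.scoreMatrix β θ₀) *ᵥ (x.1 - S.cellProb θ₀))
      =o[S.minFilter β θ₀] fun x ↦ x.1 - S.cellProb θ₀ := by
  set l := S.minFilter β θ₀
  have hθ : Tendsto Prod.snd l (𝓝 θ₀) := tendsto_snd_minFilter hβ hθ₀
  have hU : Tendsto (fun x : (Fin (S.L + 1) → ℝ) × (Fin 2 → ℝ) ↦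
      S.scoreMatrix β x.2 - S.scoreMatrix β θ₀) l (𝓝 0) :=
    tendsto_sub_nhds_zero_iff.2 ((continuousAt_scoreMatrix hθ₀ β).tendsto.comp hθ)
  have hd : (fun x : (Fin (S.L + 1) → ℝ) × (Fin 2 → ℝ) ↦ S.cellProb x.2 - S.cellProb θ₀ -
      S.W θ₀ *ᵥ (x.2 - θ₀)) =o[l] fun x ↦ x.2 - θ₀ :=
    (hasFDerivAt_cellProb_pi hθ₀).isLittleO.comp_tendsto hθ
  have hO : (fun x : (Fin (S.L + 1) → ℝ) × (Fin 2 → ℝ) ↦ S.cellProb x.2 - S.cellProb θ₀)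
      =O[l] fun x ↦ x.2 - θ₀ :=
    ((hasFDerivAt_cellProb_pi hθ₀).isBigO_sub).comp_tendsto hθ
  -- the error term splits into a part that is small against `θ - θ₀` and one against `p - π(θ₀)`
  set R₁ : (Fin (S.L + 1) → ℝ) × (Fin 2 → ℝ) → Fin 2 → ℝ := fun x ↦
    (S.J β θ₀)⁻¹ *ᵥ (-(S.scoreMatrix β θ₀ *ᵥ (S.cellProb x.2 - S.cellProb θ₀ -
      S.W θ₀ *ᵥ (x.2 - θ₀))) -
      (S.scoreMatrix β x.2 - S.scoreMatrix β θ₀) *ᵥ (S.cellProb x.2 - S.cellProb θ₀)) with hR₁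
  set R₂ : (Fin (S.L + 1) → ℝ) × (Fin 2 → ℝ) → Fin 2 → ℝ := fun x ↦ (S.J β θ₀)⁻¹ *ᵥ
    ((S.scoreMatrix β x.2 - S.scoreMatrix β θ₀) *ᵥ (x.1 - S.cellProb θ₀)) with hR₂
  have h₁ : R₁ =o[l] fun x ↦ x.2 - θ₀ :=
    (isBigO_mulVec _ _).trans_isLittleO <|
      (((isBigO_mulVec _ _).trans_isLittleO hd).neg_left).sub
        ((isLittleO_mulVec hU _).trans_isBigO hO)
  have h₂ : R₂ =o[l] fun x ↦ x.1 - S.cellProb θ₀ :=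
    (isBigO_mulVec _ _).trans_isLittleO (isLittleO_mulVec hU _)
  have hkey : ∀ᶠ x in l, x.2 - θ₀ - ((S.J β θ₀)⁻¹ * S.scoreMatrix β θ₀) *ᵥ
      (x.1 - S.cellProb θ₀) = R₁ x + R₂ x := by
    filter_upwards [eventually_minFilter] with x hx
    have h0 := hx.2.scoreMatrix_mulVec_eq_zero hβ hx.1
    have h1 : x.2 - θ₀ = (S.J β θ₀)⁻¹ *ᵥ (S.scoreMatrix β θ₀ *ᵥ (S.W θ₀ *ᵥ (x.2 - θ₀))) := by
      rw [mulVec_mulVec, mulVec_mulVec, Matrix.mul_assoc,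
        ← J_eq_scoreMatrix_mul, nonsing_inv_mul _ (isUnit_det_J hθ₀), one_mulVec]
    nth_rw 1 [h1]
    rw [hR₁, hR₂, ← mulVec_mulVec]
    simp only
    rw [← mulVec_add, ← mulVec_sub]
    congr 1
    simp only [mulVec_sub, sub_mulVec] at h0 ⊢
    rw [sub_eq_zero.1 h0]
    abel
  have hO₂ : (fun x : (Fin (S.L + 1) → ℝ) × (Fin 2 → ℝ) ↦ x.2 - θ₀)
      =O[l] fun x ↦ x.1 - S.cellProb θ₀ := by
    refine h₁.right_isBigO_sub.trans (IsBigO.congr' ((isBigO_mulVec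
      ((S.J β θ₀)⁻¹ * S.scoreMatrix β θ₀) _).add h₂.isBigO) ?_ (.refl _ _))
    filter_upwards [hkey] with x hx
    rw [sub_eq_iff_eq_add.1 hx]
    abel
  exact ((h₁.trans_isBigO hO₂).add h₂).congr' (hkey.mono fun x hx ↦ hx.symm) (.refl _ _)

variable (S) in
/-- The gradient at `π(θ₀)` of the studentized functional
`p ↦ (mᵀ J_β⁻¹ K_β J_β⁻¹ m)^{-1/2} (mᵀ θ(p) - d)`. -/
noncomputable def influence (β : ℝ) (m θ₀ : Fin 2 → ℝ) (c : Fin (S.L + 1)) : ℝ :=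
  S.asymptoticVariance β m θ₀ ^ (-(1 / 2) : ℝ) *
    (S.cellProb θ₀ c ^ (β - 1) * (S.W θ₀ *ᵥ ((S.J β θ₀)⁻¹ *ᵥ m)) c)

lemma influence_variance (hθ₀ : θ₀ ∈ paramSpace) {m : Fin 2 → ℝ} (hm : m ≠ 0) :
    ∑ c, S.cellProb θ₀ c * S.influence β m θ₀ c ^ 2 -
      (∑ c, S.cellProb θ₀ c * S.influence β m θ₀ c) ^ 2 = 1 := by
  have hpos := asymptoticVariance_pos (S := S) (β := β) hθ₀ hm
  have h := asymptoticVariance_eq (S := S) (β := β) (θ := θ₀) m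
  rw [dotProduct_K_mulVec hθ₀] at h
  have hs : (S.asymptoticVariance β m θ₀ ^ (-(1 / 2) : ℝ)) ^ 2 *
      S.asymptoticVariance β m θ₀ = 1 := by
    rw [← Real.rpow_natCast, ← Real.rpow_mul hpos.le, ← Real.rpow_add_one hpos.ne']
    norm_num
  simp only [influence]
  generalize S.asymptoticVariance β m θ₀ ^ (-(1 / 2) : ℝ) = v at *
  rw [h] at hs
  refine Eq.trans ?_ hs
  rw [mul_sub, Finset.mul_sum, ← mul_pow, Finset.mul_sum]
  congr 1
  · exact Finset.sum_congr rfl fun c _ ↦ by ring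
  · congr 1
    exact Finset.sum_congr rfl fun c _ ↦ by ring

lemma influence_dotProduct (m : Fin 2 → ℝ) (w : Fin (S.L + 1) → ℝ) :
    S.influence β m θ₀ ⬝ᵥ w = S.asymptoticVariance β m θ₀ ^ (-(1 / 2) : ℝ) *
      (m ⬝ᵥ ((S.J β θ₀)⁻¹ * S.scoreMatrix β θ₀) *ᵥ w) := by
  rw [← mulVec_mulVec, dotProduct_mulVec, ← mulVec_transpose, transpose_nonsing_inv, J_transpose,
    scoreMatrix, ← mulVec_mulVec, dotProduct_mulVec, vecMul_transpose, dotProduct, dotProduct,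
    Finset.mul_sum]
  refine Finset.sum_congr rfl fun c _ ↦ ?_
  rw [mulVec_diagonal, influence]
  ring

open Asymptotics in
/-- The studentized functional is differentiable at `π(θ₀)`. -/
lemma studentized_sub_isLittleO (hβ : 0 ≤ β) (hθ₀ : θ₀ ∈ paramSpace) {m : Fin 2 → ℝ}
    (hm : m ≠ 0) {d : ℝ} (hd : m ⬝ᵥ θ₀ = d) :
    (fun x : (Fin (S.L + 1) → ℝ) × (Fin 2 → ℝ) ↦
        S.asymptoticVariance β m x.2 ^ (-(1 / 2) : ℝ) * (m ⬝ᵥ x.2 - d) -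
          S.influence β m θ₀ ⬝ᵥ (x.1 - S.cellProb θ₀))
      =o[S.minFilter β θ₀] fun x ↦ x.1 - S.cellProb θ₀ := by
  set l := S.minFilter β θ₀
  set A := (S.J β θ₀)⁻¹ * S.scoreMatrix β θ₀
  set v := S.asymptoticVariance β m θ₀ ^ (-(1 / 2) : ℝ)
  have hlin : (fun x : (Fin (S.L + 1) → ℝ) × (Fin 2 → ℝ) ↦
      m ⬝ᵥ (x.2 - θ₀ - A *ᵥ (x.1 - S.cellProb θ₀))) =o[l] fun x ↦ x.1 - S.cellProb θ₀ := by
    refine IsLittleO.fun_sum fun i _ ↦ ?_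
    exact (isLittleO_pi.1 (minimizer_sub_isLittleO hβ hθ₀) i).const_mul_left (m i)
  have hmA : (fun x : (Fin (S.L + 1) → ℝ) × (Fin 2 → ℝ) ↦
      m ⬝ᵥ A *ᵥ (x.1 - S.cellProb θ₀)) =O[l] fun x ↦ x.1 - S.cellProb θ₀ := by
    refine IsBigO.fun_sum fun i _ ↦ ?_
    exact (isBigO_pi.1 (isBigO_mulVec A _) i).const_mul_left (m i)
  have hv : Tendsto (fun x : (Fin (S.L + 1) → ℝ) × (Fin 2 → ℝ) ↦
      S.asymptoticVariance β m x.2 ^ (-(1 / 2) : ℝ)) l (𝓝 v) :=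
    (((continuousAt_asymptoticVariance hθ₀ β m).rpow_const
      (.inl (asymptoticVariance_pos hθ₀ hm).ne')).tendsto).comp (tendsto_snd_minFilter hβ hθ₀)
  have hv0 : (fun x : (Fin (S.L + 1) → ℝ) × (Fin 2 → ℝ) ↦
      S.asymptoticVariance β m x.2 ^ (-(1 / 2) : ℝ) - v) =o[l] fun _ ↦ (1 : ℝ) :=
    (isLittleO_one_iff ℝ).2 (tendsto_sub_nhds_zero_iff.2 hv)
  have h1 := (hv.isBigO_one ℝ).mul_isLittleO hlin.norm_right
  have h2 := hv0.mul_isBigO hmA.norm_right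
  simp only [one_mul] at h1 h2
  refine ((h1.add h2).congr_left fun x ↦ ?_).of_norm_right
  rw [influence_dotProduct, dotProduct_sub, dotProduct_sub, hd]
  ring

/-- An `ε`-`δ` form of `studentized_sub_isLittleO`. -/
lemma exists_studentized_sub_le (hβ : 0 ≤ β) (hθ₀ : θ₀ ∈ paramSpace) {m : Fin 2 → ℝ}
    (hm : m ≠ 0) {d : ℝ} (hd : m ⬝ᵥ θ₀ = d) {ε : ℝ} (hε : 0 < ε) :
    ∃ δ > 0, ∀ p θ, p ∈ stdSimplex ℝ (Fin (S.L + 1)) → ‖p - S.cellProb θ₀‖ < δ →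
      S.IsDivergenceMin β p θ →
      |S.asymptoticVariance β m θ ^ (-(1 / 2) : ℝ) * (m ⬝ᵥ θ - d) -
        S.influence β m θ₀ ⬝ᵥ (p - S.cellProb θ₀)| ≤ ε * ‖p - S.cellProb θ₀‖ := by
  have h := (studentized_sub_isLittleO (S := S) hβ hθ₀ hm hd).bound hε
  rw [minFilter, eventually_inf_principal, eventually_comap, Metric.eventually_nhds_iff] at h
  obtain ⟨δ, hδ, h⟩ := h
  exact ⟨δ, hδ, fun p θ hp hpd hθ ↦ h (by rwa [dist_eq_norm]) (p, θ) rfl ⟨hp, hθ⟩⟩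

end StepStressPlan

/-! ### Multinomial counts: central limit theorem and delta method -/

section Multinomial

variable {ι : Type*} [Fintype ι] {p : ι → ℝ}

/-- A discrete probability distribution on `ℝ`: the value `v j` has probability `p j`. -/
noncomputable def weightedDirac (p v : ι → ℝ) : Measure ℝ :=
  ∑ j, ENNReal.ofReal (p j) • Measure.dirac (v j)

lemma isProbabilityMeasure_weightedDirac (hp : p ∈ stdSimplex ℝ ι) (v : ι → ℝ) :
    IsProbabilityMeasure (weightedDirac p v) := by
  refine ⟨?_⟩
  simp only [weightedDirac, Measure.finsetSum_apply, Measure.smul_apply, measure_univ,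
    smul_eq_mul, mul_one]
  rw [← ENNReal.ofReal_sum_of_nonneg fun j _ ↦ hp.1 j, hp.2, ENNReal.ofReal_one]

lemma integral_weightedDirac {E : Type*} [NormedAddCommGroup E] [NormedSpace ℝ E]
    [CompleteSpace E] (hp : p ∈ stdSimplex ℝ ι) (v : ι → ℝ) (f : ℝ → E) :
    ∫ x, f x ∂(weightedDirac p v) = ∑ j, p j • f (v j) := by
  rw [weightedDirac, integral_finsetSum_measure fun j _ ↦
    (integrable_dirac (by simp)).smul_measure ENNReal.ofReal_ne_top]
  refine Finset.sum_congr rfl fun j _ ↦ ?_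
  rw [integral_smul_measure, integral_dirac, ENNReal.toReal_ofReal (hp.1 j)]

variable [DecidableEq ι]

lemma integral_multinomialMeasure {E : Type*} [NormedAddCommGroup E] [NormedSpace ℝ E]
    [CompleteSpace E] (hp : ∀ j, 0 ≤ p j) (N : ℕ) (f : (ι → ℕ) → E) :
    ∫ n, f n ∂(multinomialMeasure N p) = ∑ n ∈ Finset.piAntidiag Finset.univ N,
      ((Nat.multinomial Finset.univ n : ℝ) * ∏ j, p j ^ n j) • f n := by
  rw [multinomialMeasure, integral_finsetSum_measure fun j _ ↦
    (integrable_dirac (by simp)).smul_measure ENNReal.ofReal_ne_top]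
  refine Finset.sum_congr rfl fun n _ ↦ ?_
  rw [integral_smul_measure, integral_dirac, ENNReal.toReal_ofReal
    (mul_nonneg (Nat.cast_nonneg _) (Finset.prod_nonneg fun j _ ↦ pow_nonneg (hp j) _))]

lemma ae_sum_eq_multinomialMeasure (N : ℕ) (p : ι → ℝ) :
    ∀ᵐ n ∂(multinomialMeasure N p), ∑ j, n j = N := by
  rw [multinomialMeasure, ae_iff]
  simp only [Measure.finsetSum_apply, Measure.smul_apply, smul_eq_mul]
  refine Finset.sum_eq_zero fun n hn ↦ ?_
  rw [Finset.mem_piAntidiag] at hn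
  rw [Measure.dirac_apply]
  simp [hn.1]

/-- The characteristic function of a linear form in multinomial counts, by the multinomial
theorem. -/
lemma integral_exp_multinomialMeasure (hp : p ∈ stdSimplex ℝ ι) (N : ℕ) (v : ι → ℝ) (t : ℝ) :
    ∫ n, Complex.exp (t * (∑ j, (n j : ℝ) * v j : ℝ) * Complex.I) ∂(multinomialMeasure N p) =
      charFun (weightedDirac p v) t ^ N := by
  rw [integral_multinomialMeasure hp.1, charFun_apply_real, integral_weightedDirac hp,
    Finset.sum_pow_eq_sum_piAntidiag]
  refine Finset.sum_congr rfl fun n _ ↦ ?_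
  rw [Complex.real_smul]
  push_cast
  rw [mul_assoc]
  congr 1
  simp only [Complex.real_smul, mul_pow, ← Complex.exp_nat_mul]
  rw [Finset.prod_mul_distrib, ← Complex.exp_sum, Finset.mul_sum, Finset.sum_mul]
  congr 2
  exact Finset.sum_congr rfl fun j _ ↦ by ring

variable {Ω : Type*} [MeasurableSpace Ω] {P : Measure Ω}
  {n : ℕ → Ω → ι → ℕ}

lemma charFun_map_multinomial (hp : p ∈ stdSimplex ℝ ι)
    (hn : ∀ N, HasLaw (n N) (multinomialMeasure N p) P) (v : ι → ℝ) (N : ℕ) (t : ℝ) :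
    charFun (P.map fun ω ↦ (√N)⁻¹ * ∑ j, (n N ω j : ℝ) * v j) t =
      charFun (weightedDirac p v) ((√N)⁻¹ * t) ^ N := by
  have hm : Measurable fun n : ι → ℕ ↦ (√N)⁻¹ * ∑ j, (n j : ℝ) * v j := .of_discrete
  have hmap : P.map (fun ω ↦ (√N)⁻¹ * ∑ j, (n N ω j : ℝ) * v j) =
      (multinomialMeasure N p).map fun n ↦ (√N)⁻¹ * ∑ j, (n j : ℝ) * v j := by
    rw [← (hn N).map_eq, AEMeasurable.map_map_of_aemeasurable hm.aemeasurable (hn N).aemeasurable]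
    rfl
  rw [hmap, charFun_apply_real, integral_map hm.aemeasurable (by fun_prop),
    ← integral_exp_multinomialMeasure hp]
  congr 1 with n
  congr 2
  push_cast
  ring

variable [IsProbabilityMeasure P]

/-- The central limit theorem for standardized linear forms in multinomial counts. -/
lemma tendstoInDistribution_multinomial (hp : p ∈ stdSimplex ℝ ι)
    (hn : ∀ N, HasLaw (n N) (multinomialMeasure N p) P) {v : ι → ℝ}
    (hv0 : ∑ j, p j * v j = 0) (hv1 : ∑ j, p j * v j ^ 2 = 1) :
    TendstoInDistribution (fun (N : ℕ) ω ↦ (√N)⁻¹ * ∑ j, (n N ω j : ℝ) * v j) atTop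
      (id : ℝ → ℝ) (fun _ ↦ P) (gaussianReal 0 1) where
  forall_aemeasurable N := (Measurable.of_discrete (f := fun n : ι → ℕ ↦
    (√N)⁻¹ * ∑ j, (n j : ℝ) * v j)).comp_aemeasurable (hn N).aemeasurable
  tendsto := by
    have := isProbabilityMeasure_weightedDirac hp v
    refine ProbabilityMeasure.tendsto_iff_tendsto_charFun.2 fun t ↦ ?_
    have h := tendsto_charFun_inv_sqrt_mul_pow (P := weightedDirac p v) (X := id)
      aemeasurable_id (by simpa [integral_weightedDirac hp] using hv0)
      (by simpa [integral_weightedDirac hp] using hv1) t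
    simpa [charFun_map_multinomial hp hn, charFun_gaussianReal, neg_div] using h

/-- The standardized counts of each cell are tight, by the central limit theorem. -/
lemma exists_measureReal_abs_count_sub_le (hp : p ∈ stdSimplex ℝ ι)
    (hn : ∀ N, HasLaw (n N) (multinomialMeasure N p) P) {j : ι} (hj0 : 0 < p j) (hj1 : p j < 1)
    {η : ℝ} (hη : 0 < η) :
    ∃ M > 0, ∀ N : ℕ, 0 < N → P.real {ω | M < √N * |empiricalProb N (n N ω) j - p j|} ≤ η := by
  have hs : 0 < p j * (1 - p j) := mul_pos hj0 (sub_pos.2 hj1)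
  set s := √(p j * (1 - p j))
  have hs0 : 0 < s := Real.sqrt_pos.2 hs
  have hs1 : s ≤ 1 := Real.sqrt_le_one.2 (by nlinarith)
  have hs2 : s ^ 2 = p j * (1 - p j) := Real.sq_sqrt hs.le
  let v : ι → ℝ := fun i ↦ ((Pi.single j 1 : ι → ℝ) i - p j) / s
  have hv0 : ∑ i, p i * v i = 0 := by
    simp only [v, ← mul_div_assoc, ← Finset.sum_div, mul_sub, Finset.sum_sub_distrib,
      ← Finset.sum_mul, hp.2]
    simp [Pi.single_apply]
  have hv1 : ∑ i, p i * v i ^ 2 = 1 := by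
    have h (i : ι) : p i * v i ^ 2 =
        (p i * ((Pi.single j 1 : ι → ℝ) i * (1 - 2 * p j)) + p i * p j ^ 2) / s ^ 2 := by
      have : ((Pi.single j 1 : ι → ℝ) i) ^ 2 = (Pi.single j 1 : ι → ℝ) i := by
        rcases eq_or_ne i j with rfl | h <;> simp [*]
      simp only [v, div_pow, sub_sq, this]
      ring
    simp only [h, ← Finset.sum_div, Finset.sum_add_distrib, ← Finset.sum_mul, ← mul_assoc, hp.2]
    rw [hs2, div_eq_one_iff_eq hs.ne']
    simp [Pi.single_apply]
    ring
  have hclt := tendstoInDistribution_multinomial hp hn hv0 hv1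
  have hmeas := hclt.forall_aemeasurable
  have hprob (N : ℕ) : IsProbabilityMeasure (P.map fun ω ↦ (√N)⁻¹ * ∑ i, (n N ω i : ℝ) * v i) :=
    Measure.isProbabilityMeasure_map (hmeas N)
  have htight := isTightMeasureSet_of_tendsto_charFun
    (μ := fun N : ℕ ↦ P.map fun ω ↦ (√N)⁻¹ * ∑ i, (n N ω i : ℝ) * v i)
    (continuous_charFun (μ := gaussianReal 0 1)).continuousAt (fun t ↦ by
      simpa using! ProbabilityMeasure.tendsto_iff_tendsto_charFun.1 hclt.tendsto t)
  have hlim := tendsto_measure_norm_gt_of_isTightMeasureSet htight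
  obtain ⟨M, hM, hM0⟩ := ((hlim.eventually_le_const (ENNReal.ofReal_pos.2 hη)).and
    (eventually_gt_atTop 0)).exists
  refine ⟨M, hM0, fun N hN ↦ ENNReal.toReal_le_of_le_ofReal hη.le ?_⟩
  refine le_trans ?_ ((le_iSup₂ (f := fun (μ : Measure ℝ) (_ : μ ∈ _) ↦ μ {x | M < ‖x‖}) _
    (Set.mem_range_self N)).trans hM)
  rw [Measure.map_apply_of_aemeasurable (hmeas N) (measurableSet_lt measurable_const
    measurable_norm)]
  refine measure_mono_ae ?_
  have hsum := ((hn N).ae_iff (p := fun n ↦ ∑ j, n j = N)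
    (Measurable.of_discrete)).2 (ae_sum_eq_multinomialMeasure N p)
  filter_upwards [hsum] with ω hω hlt
  have hN0 : (0 : ℝ) < N := by exact_mod_cast hN
  have hN' : ∑ i, (n N ω i : ℝ) = N := by exact_mod_cast hω
  have hX : (√N)⁻¹ * ∑ i, (n N ω i : ℝ) * v i =
      (√N * (empiricalProb N (n N ω) j - p j)) / s := by
    simp only [v, ← mul_div_assoc, ← Finset.sum_div, mul_sub, Finset.sum_sub_distrib,
      ← Finset.sum_mul, hN']
    simp only [Pi.single_apply, mul_ite, mul_one, mul_zero, Finset.sum_ite_eq', Finset.mem_univ,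
      if_true, empiricalProb]
    have hsq := Real.mul_self_sqrt hN0.le
    have : √(N : ℝ) ≠ 0 := (Real.sqrt_pos.2 hN0).ne'
    field_simp
    rw [pow_two, hsq]
  change M < ‖(√N)⁻¹ * ∑ i, (n N ω i : ℝ) * v i‖
  change M < √N * |empiricalProb N (n N ω) j - p j| at hlt
  rw [hX, Real.norm_eq_abs, abs_div, abs_mul, abs_of_nonneg (Real.sqrt_nonneg _), abs_of_pos hs0,
    lt_div_iff₀ hs0]
  exact (mul_le_of_le_one_right hM0.le hs1).trans_lt hlt

/-- Tightness of `√N (p̂ - p)` for multinomial counts. -/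
lemma exists_measureReal_norm_empiricalProb_sub_le (hp : p ∈ stdSimplex ℝ ι)
    (hn : ∀ N, HasLaw (n N) (multinomialMeasure N p) P) (hp0 : ∀ j, 0 < p j)
    (hp1 : ∀ j, p j < 1) {η : ℝ} (hη : 0 < η) :
    ∃ M > 0, ∀ N : ℕ, 0 < N → P.real {ω | M < √N * ‖empiricalProb N (n N ω) - p‖} ≤ η := by
  have hcard : 0 < (Fintype.card ι : ℝ) + 1 := by positivity
  choose M hM0 hM using fun j ↦ exists_measureReal_abs_count_sub_le hp hn (hp0 j) (hp1 j)
    (div_pos hη hcard)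
  have hMsum : 0 ≤ ∑ j, M j := Finset.sum_nonneg fun j _ ↦ (hM0 j).le
  refine ⟨∑ j, M j + 1, by positivity, fun N hN ↦ ?_⟩
  have hN0 : 0 < √(N : ℝ) := Real.sqrt_pos.2 (by exact_mod_cast hN)
  calc P.real {ω | ∑ j, M j + 1 < √N * ‖empiricalProb N (n N ω) - p‖}
      ≤ P.real (⋃ j, {ω | M j < √N * |empiricalProb N (n N ω) j - p j|}) := by
        refine measureReal_mono fun ω hω ↦ ?_
        by_contra! hc
        simp only [Set.mem_iUnion, Set.mem_ofPred_eq, not_exists, not_lt] at hc hω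
        refine hω.not_ge ?_
        rw [mul_comm, ← le_div_iff₀ hN0, pi_norm_le_iff_of_nonneg (by positivity)]
        intro j
        rw [le_div_iff₀ hN0, mul_comm]
        exact (hc j).trans ((Finset.single_le_sum (fun i _ ↦ (hM0 i).le)
          (Finset.mem_univ j)).trans (le_add_of_nonneg_right one_pos.le))
    _ ≤ ∑ j, P.real {ω | M j < √N * |empiricalProb N (n N ω) j - p j|} :=
        measureReal_iUnion_fintype_le _
    _ ≤ ∑ _j : ι, η / (Fintype.card ι + 1) := Finset.sum_le_sum fun j _ ↦ hM j N hN
    _ ≤ η := by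
        rw [Finset.sum_const, nsmul_eq_mul, Finset.card_univ, mul_div_assoc', div_le_iff₀ hcard]
        linarith

/-- The delta method for multinomial counts: a statistic that is, up to a small multiple of the
distance, linear near the true probability vector has the limit law of its linearization. -/
lemma tendstoInDistribution_of_linearization (hp : p ∈ stdSimplex ℝ ι)
    (hn : ∀ N, HasLaw (n N) (multinomialMeasure N p) P) (hp0 : ∀ j, 0 < p j)
    (hp1 : ∀ j, p j < 1) {a : ι → ℝ}
    (ha : ∑ j, p j * a j ^ 2 - (∑ j, p j * a j) ^ 2 = 1) {T : ℕ → (ι → ℕ) → ℝ}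
    (hT : ∀ ε > 0, ∃ δ > 0, ∀ N > 0, ∀ n : ι → ℕ, ∑ j, n j = N →
      ‖empiricalProb N n - p‖ < δ →
        |T N n - a ⬝ᵥ (empiricalProb N n - p)| ≤ ε * ‖empiricalProb N n - p‖) :
    TendstoInDistribution (fun (N : ℕ) ω ↦ √N * T N (n N ω)) atTop
      (id : ℝ → ℝ) (fun _ ↦ P) (gaussianReal 0 1) := by
  -- centring `a` does not change the linearization, because `p̂ - p` sums to zero
  set μ := ∑ j, p j * a j with hμ
  have hv0 : ∑ j, p j * (a j - μ) = 0 := by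
    simp only [mul_sub, Finset.sum_sub_distrib, ← Finset.sum_mul, hp.2]
    simp [hμ]
  have hv1 : ∑ j, p j * (a j - μ) ^ 2 = 1 := by
    have h (j : ι) : p j * (a j - μ) ^ 2 = p j * a j ^ 2 - 2 * μ * (p j * a j) + μ ^ 2 * p j := by
      ring
    simp only [h, Finset.sum_add_distrib, Finset.sum_sub_distrib, ← Finset.mul_sum, hp.2, ← hμ]
    linarith
  refine tendstoInDistribution_of_tendstoInMeasure_sub _ _
    (tendstoInDistribution_multinomial hp hn hv0 hv1) ?_ fun N ↦
      (Measurable.of_discrete (f := fun n : ι → ℕ ↦ √N * T N n)).comp_aemeasurable (hn N).aemeasurable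
  rw [tendstoInMeasure_iff_measureReal_norm]
  intro c hc
  rw [Metric.tendsto_atTop]
  intro η hη
  obtain ⟨M, hM0, hM⟩ := exists_measureReal_norm_empiricalProb_sub_le hp hn hp0 hp1 (half_pos hη)
  -- the factor `2` makes the remainder at most `c / 2` where `√N ‖p̂ - p‖ ≤ M`
  obtain ⟨δ, hδ, hTδ⟩ := hT (c / (2 * M)) (by positivity)
  -- for `N > (M / δ) ^ 2` the event `√N ‖p̂ - p‖ ≤ M` lies in the region of linearization
  obtain ⟨N₀, hN₀⟩ := exists_nat_gt ((M / δ) ^ 2)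
  refine ⟨N₀ + 1, fun N hN ↦ ?_⟩
  have hNpos : 0 < N := by omega
  have hN0 : (0 : ℝ) < N := by exact_mod_cast hNpos
  have hsq0 : 0 < √(N : ℝ) := Real.sqrt_pos.2 hN0
  have hMδ : M < √N * δ := by
    rw [← div_lt_iff₀ hδ]
    refine Real.lt_sqrt_of_sq_lt (hN₀.trans ?_)
    exact_mod_cast hN
  rw [Real.dist_eq, sub_zero, abs_of_nonneg measureReal_nonneg]
  refine lt_of_le_of_lt ?_ (half_lt_self hη)
  refine le_trans (ENNReal.toReal_mono (measure_ne_top _ _) (measure_mono_ae ?_)) (hM N hNpos)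
  have hsum := ((hn N).ae_iff (p := fun n ↦ ∑ j, n j = N)
    (Measurable.of_discrete)).2 (ae_sum_eq_multinomialMeasure N p)
  filter_upwards [hsum] with ω hω hlt
  change M < √N * ‖empiricalProb N (n N ω) - p‖
  change c ≤ ‖√N * T N (n N ω) - (√N)⁻¹ * ∑ j, (n N ω j : ℝ) * (a j - μ) - 0‖ at hlt
  by_contra! hle
  have hN' : ∑ i, (n N ω i : ℝ) = N := by exact_mod_cast hω
  have hlin : (√N)⁻¹ * ∑ j, (n N ω j : ℝ) * (a j - μ) =
      √N * (a ⬝ᵥ (empiricalProb N (n N ω) - p)) := by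
    have e1 : ∑ j, (n N ω j : ℝ) * (a j - μ) = ∑ j, (n N ω j : ℝ) * a j - N * μ := by
      simp only [mul_sub, Finset.sum_sub_distrib, ← Finset.sum_mul, hN']
    have e2 : a ⬝ᵥ (empiricalProb N (n N ω) - p) = (∑ j, (n N ω j : ℝ) * a j) / N - μ := by
      simp only [dotProduct, Pi.sub_apply, mul_sub, Finset.sum_sub_distrib, hμ, Finset.sum_div,
        empiricalProb]
      congr 1 <;> exact Finset.sum_congr rfl fun j _ ↦ by ring
    have hsq := Real.mul_self_sqrt hN0.le
    rw [e1, e2]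
    field_simp
    rw [pow_two, hsq]
  have hδ' : ‖empiricalProb N (n N ω) - p‖ < δ := by
    by_contra! h
    exact (hMδ.trans_le (mul_le_mul_of_nonneg_left h hsq0.le)).not_ge hle
  have hb := hTδ N hNpos _ hω hδ'
  rw [hlin, sub_zero, ← mul_sub, Real.norm_eq_abs, abs_mul, abs_of_pos hsq0] at hlt
  have : c ≤ c / 2 := calc
    c ≤ √N * (c / (2 * M) * ‖empiricalProb N (n N ω) - p‖) :=
      hlt.trans (mul_le_mul_of_nonneg_left hb hsq0.le)
    _ = c / (2 * M) * (√N * ‖empiricalProb N (n N ω) - p‖) := by ring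
    _ ≤ c / (2 * M) * M := by gcongr
    _ = c / 2 := by field_simp
  linarith

end Multinomial

/-! ### Asymptotic normality of the studentized estimator -/

namespace StepStressPlan

lemma cellProb_lt_one {S : StepStressPlan} {θ : Fin 2 → ℝ} (hθ : θ ∈ paramSpace)
    (c : Fin (S.L + 1)) : S.cellProb θ c < 1 := by
  have hL : 0 < S.L := by
    have := S.l_lt 0 (by have := S.two_le_k; omega)
    have := S.l_le (i := 1) (by have := S.two_le_k; omega)
    simp only [zero_add] at *
    omega
  have : Nontrivial (Fin (S.L + 1)) := Fin.nontrivial_iff_two_le.2 (by omega)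
  obtain ⟨c', hc'⟩ := exists_ne c
  rw [← sum_cellProb hθ]
  exact Finset.single_lt_sum hc' (Finset.mem_univ c) (Finset.mem_univ c') (cellProb_pos hθ c')
    fun i _ _ ↦ (cellProb_pos hθ i).le

end StepStressPlan

lemma empiricalProb_mem_stdSimplex {ι : Type*} [Fintype ι] {N : ℕ} (hN : 0 < N) {n : ι → ℕ}
    (hn : ∑ j, n j = N) : empiricalProb N n ∈ stdSimplex ℝ ι := by
  refine ⟨fun j ↦ div_nonneg (Nat.cast_nonneg _) (Nat.cast_nonneg _), ?_⟩
  simp only [empiricalProb]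
  rw [← Finset.sum_div, ← Nat.cast_sum, hn, div_self (by exact_mod_cast hN.ne')]

theorem theorem11 (S : StepStressPlan) (β : ℝ) (hβ : 0 ≤ β)
    (m : Fin 2 → ℝ) (hm : m ≠ 0) (d : ℝ)
    (θ₀ : Fin 2 → ℝ) (hθ₀ : θ₀ ∈ paramSpace) (hH₀ : m ⬝ᵥ θ₀ = d)
    (est : ℕ → (Fin (S.L + 1) → ℕ) → Fin 2 → ℝ) (hest : S.IsMDPDE β est)
    {Ω : Type*} [MeasurableSpace Ω] (P : Measure Ω) [IsProbabilityMeasure P]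
    (n : ℕ → Ω → Fin (S.L + 1) → ℕ)
    (hn : ∀ N, HasLaw (n N) (multinomialMeasure N (S.cellProb θ₀)) P) :
    TendstoInDistribution (fun N ω => S.zStat β m d N (est N (n N ω))) atTop
      (id : ℝ → ℝ) (fun _ => P) (gaussianReal 0 1) := by
  have h := tendstoInDistribution_of_linearization
    (StepStressPlan.cellProb_mem_stdSimplex hθ₀) hn (StepStressPlan.cellProb_pos hθ₀)
    (StepStressPlan.cellProb_lt_one hθ₀)
    (StepStressPlan.influence_variance (S := S) (β := β) hθ₀ hm)
    (T := fun N n ↦ S.asymptoticVariance β m (est N n) ^ (-(1 / 2) : ℝ) * (m ⬝ᵥ est N n - d)) ?_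
  · simpa only [← mul_assoc] using! h
  intro ε hε
  obtain ⟨δ₁, hδ₁, h₁⟩ := StepStressPlan.exists_studentized_sub_le (S := S) hβ hθ₀ hm hH₀ hε
  obtain ⟨δ₂, hδ₂, h₂⟩ := Metric.eventually_nhds_iff.1
    (StepStressPlan.eventually_exists_isDivergenceMin (S := S) hβ hθ₀)
  refine ⟨min δ₁ δ₂, lt_min hδ₁ hδ₂, fun N hN n hsum hlt ↦ ?_⟩
  have hp := empiricalProb_mem_stdSimplex hN hsum
  exact h₁ _ _ hp (hlt.trans_le (min_le_left _ _)) <| hest N n hsum <|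
    h₂ (by rw [dist_eq_norm]; exact hlt.trans_le (min_le_right _ _)) hp
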